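/- Let $N\ge 0$ and $\ell\ge 2$ be integers, let $J\in\mathbb C$, and let $\mathfrak H_N=(\mathbb C^2)^{\otimes N}$. Let $\sigma^1,\sigma^2,\sigma^3$ be the Pauli matrices and let $\sigma^a_k$ be $\sigma^a$ acting on the $k$-th tensor factor. Let $$\mathcal H_N=\frac J4\sum_{k=1}^N\bigl(\sigma^1_k\sigma^1_{k+1}+\sigma^2_k\sigma^2_{k+1}+\sigma^3_k\sigma^3_{k+1}-\mathbb I_N\bigr),\qquad \sigma^a_{N+1}=\sigma^a_1,$$ be the Hamiltonian of the periodic XXX chain. Put $L_k(\lambda)=\lambda\, I\otimes\mathbb I_N+\frac i2\sum_{a=1}^3\sigma^a\otimes\sigma^a_k$ on $\mathbb C^2\otimes\mathfrak H_N$ and $T_N(\lambda)=L_N(\lambda)\cdots L_1(\lambda)$, and let $B_N(\lambda)$ be the upper right entry of $T_N(\lambda)$ written as a $2\times2$ matrix of operators on $\mathfrak H_N$. Let $|0\rangle_N=\binom10\otimes\cdots\otimes\binom10$. Let $\lambda_1=\frac i2,\ \lambda_2=-\frac i2,\ \lambda_3,\dots,\lambda_\ell$ be pairwise distinct complex numbers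 forming a singular solution of the Bethe ansatz equations, i.e. $$\left(\frac{\lambda_k+\frac i2}{\lambda_k-\frac i2}\right)^N=\prod_{\substack{1\le j\le \ell\\ j\ne k}}\frac{\lambda_k-\lambda_j+i}{\lambda_k-\lambda_j-i}\qquad(k=3,\dots,\ell)$$ (for $k=1,2$ the equations are degenerate and impose no condition). Suppose that the number $c\in\mathbb C$ satisfies both $$c=-\frac{2}{i^{N+1}}\prod_{j=3}^\ell\frac{\lambda_j-\frac{3i}2}{\lambda_j+\frac i2}\qquad\text{and}\qquad c=2\,i^{N+1}\prod_{j=3}^\ell\frac{\lambda_j+\frac{3i}2}{\lambda_j-\frac i2}.$$ Then: (1) the limit $$\Psi_\lambda=\lim_{\epsilon\to0}\frac1{\epsilon^N}B_N\!\left(\tfrac i2+\epsilon+c\,\epsilon^N\right)B_N\!\left(-\tfrac i2+\epsilon\right)B_N(\lambda_3)\cdots B_N(\lambda_\ell)|0\rangle_N\qquad(\epsilon\in\mathbb C\setminus\{0\})$$ exists; (2) $\Psi_\lambda$ satisfies $\mathcal H_N\Psi_\lambda=\mathcal E\,\Psi_\lambda$ for some $\mathcal E\in\mathbb C$; that is,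 $\Psi_\lambda$ is an eigenvector of $\mathcal H_N$ whenever it is non-zero. -/

import Mathlib

open scoped Kronecker Matrix Topology

noncomputable section

namespace HeisenbergXXX

/-- Labels of the standard product basis of `(ℂ²)^{⊗N}`: at each site, `0` is `v₊ = (1,0)ᵗ` and
`1` is `v₋ = (0,1)ᵗ`. -/
abbrev Config (N : ℕ) : Type := Fin N → Fin 2

/-- The space of states `(ℂ²)^{⊗N}`, in coordinates with respect to the product basis. -/
abbrev Space (N : ℕ) : Type := Config N → ℂ

/-- Operators on the space of states, as matrices in the product basis. -/
abbrev Op (N : ℕ) : Type := Matrix (Config N) (Config N) ℂ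

/-- The Pauli matrices `σ¹, σ², σ³` (indexed by `0, 1, 2`). -/
def pauli : Fin 3 → Matrix (Fin 2) (Fin 2) ℂ :=
  ![!![0, 1; 1, 0], !![0, -Complex.I; Complex.I, 0], !![1, 0; 0, -1]]

/-- The Kronecker product `M₁ ⊗ ⋯ ⊗ M_N` of `N` matrices of size `2`. -/
def tensorOp {N : ℕ} (M : Fin N → Matrix (Fin 2) (Fin 2) ℂ) : Op N :=
  Matrix.of fun s t => ∏ j, M j (s j) (t j)

/-- The product vector `v₁ ⊗ ⋯ ⊗ v_N`. -/
def tensorVec {N : ℕ} (v : Fin N → Fin 2 → ℂ) : Space N :=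
  fun s => ∏ j, v j (s j)

/-- `I ⊗ ⋯ ⊗ A ⊗ ⋯ ⊗ I`, with `A` at site `k`. -/
def siteOp {N : ℕ} (k : Fin N) (A : Matrix (Fin 2) (Fin 2) ℂ) : Op N :=
  tensorOp (Function.update (fun _ => 1) k A)

/-- The Hamiltonian `(J/4) ∑ₖ (∑ₐ σₖᵃ σₖ₊₁ᵃ - 𝕀)` of the periodic spin-1/2 isotropic Heisenberg
chain of length `N`; `finRotate N` is the cyclic shift `k ↦ k + 1` of the sites. -/
def hamiltonian (N : ℕ) (J : ℂ) : Op N :=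
  (J / 4) • ∑ k : Fin N,
    ((∑ a : Fin 3, siteOp k (pauli a) * siteOp (finRotate N k) (pauli a)) - 1)

/-- The operator `L_k(u) = u I ⊗ 𝕀 + (i/2) ∑ₐ σᵃ ⊗ σₖᵃ` on `ℂ² ⊗ (ℂ²)^{⊗N}`, where the first
factor is the auxiliary space. -/
def lOp {N : ℕ} (k : Fin N) (u : ℂ) : Matrix (Fin 2 × Config N) (Fin 2 × Config N) ℂ :=
  u • ((1 : Matrix (Fin 2) (Fin 2) ℂ) ⊗ₖ (1 : Op N)) +
    (Complex.I / 2) • ∑ a : Fin 3, pauli a ⊗ₖ siteOp k (pauli a)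

/-- The matrix `T_N(u) = L_N(u) L_{N-1}(u) ⋯ L_1(u)`. -/
def transferMatrix (N : ℕ) (u : ℂ) : Matrix (Fin 2 × Config N) (Fin 2 × Config N) ℂ :=
  ((List.finRange N).reverse.map fun k => lOp k u).prod

/-- `B_N(u)`: the upper right entry of `T_N(u)`, seen as a `2 × 2` matrix (over the auxiliary
space) of operators on the space of states. -/
def bOp (N : ℕ) (u : ℂ) : Op N :=
  Matrix.of fun s t => transferMatrix N u (0, s) (1, t)

/-- The reference state `|0⟩_N = v₊ ⊗ ⋯ ⊗ v₊`. -/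
def vacuum (N : ℕ) : Space N := tensorVec fun _ => ![1, 0]

/-- The `k`-th Bethe ansatz equation for `(x_1, …, x_ℓ)`. -/
def BetheEquation (N : ℕ) {l : ℕ} (x : Fin l → ℂ) (k : Fin l) : Prop :=
  ((x k + Complex.I / 2) / (x k - Complex.I / 2)) ^ N =
    ∏ j ∈ Finset.univ.erase k, (x k - x j + Complex.I) / (x k - x j - Complex.I)

/-- The tuple `(i/2, -i/2, λ_3, …, λ_ℓ)`, with `ℓ = m + 2` and `(λ_3, …, λ_ℓ)` listed as
`μ : Fin m → ℂ`. -/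
def singularTuple {m : ℕ} (μ : Fin m → ℂ) : Fin (m + 2) → ℂ :=
  Fin.cons (Complex.I / 2) (Fin.cons (-Complex.I / 2) μ)

/-- `(i/2, -i/2, λ_3, …, λ_ℓ)` is a singular solution of the Bethe ansatz equations: its entries
are pairwise distinct, and the equations for `λ_3, …, λ_ℓ` hold. (The equations for `±i/2` have
vanishing numerators or denominators; after clearing denominators both of their sides are `0`, so
that they impose nothing. In the equations for `λ_3, …, λ_ℓ` no denominator can vanish: the
left-hand side is a non-zero number because `λ_k ≠ ±i/2`, while a vanishing factor
`λ_k - λ_j - i` would make the right-hand side `0` under `z / 0 = 0`.) -/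
def IsSingularSolution (N : ℕ) {m : ℕ} (μ : Fin m → ℂ) : Prop :=
  Function.Injective (singularTuple μ) ∧
    ∀ k : Fin m, BetheEquation N (singularTuple μ) k.succ.succ

/-- The regularized vector
`ε^{-N} B_N(i/2 + ε + c ε^N) B_N(-i/2 + ε) B_N(λ_3) ⋯ B_N(λ_ℓ) |0⟩_N`. -/
def regularizedBetheVector (N : ℕ) {m : ℕ} (μ : Fin m → ℂ) (c ε : ℂ) : Space N :=
  (1 / ε ^ N) •
    (bOp N (Complex.I / 2 + ε + c * ε ^ N) * bOp N (-Complex.I / 2 + ε) *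
      (List.ofFn fun j => bOp N (μ j)).prod) *ᵥ vacuum N

end HeisenbergXXX

end

noncomputable section

namespace HeisenbergXXX

/-! ### RTT relation for the monodromy matrix and its consequences for A, B, D. -/

section Yangian

/-! The proof runs the algebraic Bethe ansatz on a regularized tuple. The Lax matrix (u - i/2) + iP
satisfies the RTT relation, which passes to products over sites (`rttRelation_monodromy`). Hence the
B(u) commute, and A(u), D(u) move past B(v) at the cost of one exchanged term. By `offShell_action`,
the transfer matrix t(u) maps a Bethe vector with distinct parameters x to a multiple of itself
plus, for each k, a term in which x_k is replaced by u, with coefficient i/(u - x_k) times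
`betheDefect`.

The limit exists by fusion. When the parameters differ by i, Yang's R-matrix is proportional to a
symmetrizer. The row symmetrization of T(i/2 + ε) ⊗ T(-i/2 + ε) is therefore multiplicative over
sites up to a factor 1/2, and at one site it is divisible by ε. So B(i/2 + ε) B(-i/2 + ε) is ε^N
times a continuous function, and the shift cε^N only adds another multiple of ε^N
(`exists_B_mul_B_eq`). Neither the Bethe equations nor the value of c enters here.

For the eigenvector property, divide the off-shell formula by ε^N. Replacing x_k with k ≥ 3 keeps
both singular B's, so the quotient stays bounded and the defect tends to 0 by the Bethe equation.
Replacing x_1 or x_2 loses one singular B, so the defect itself must be o(ε^N); the two formulas for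
c provide this (`tendsto_betheDefect_zero_div`, `tendsto_betheDefect_one_div`). Thus t(u)Ψ ∈ ℂΨ for
every u outside the singular tuple.

Finally, t(i/2 + ε) = U(1 - iεP) + O(ε²), with U invertible and P the sum of the swaps of
neighbouring sites, while the Hamiltonian is (J/2)(P - N). Comparing the first two orders in ε gives
the claim for N ≥ 2. For N ≤ 1 the Hamiltonian is a scalar. -/

lemma commute_matrix_mul {R : Type*} [Ring R] {X Y : Matrix (Fin 2) (Fin 2) R} {x : R}
    (hX : ∀ i j, Commute x (X i j)) (hY : ∀ i j, Commute x (Y i j)) (i j : Fin 2) :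
    Commute x ((X * Y) i j) := by
  rw [Matrix.mul_apply]
  exact Commute.sum_right _ _ _ fun p _ => (hX i p).mul_right (hY p j)

lemma mul_apply_mul_mul_apply_of_commute {R : Type*} [Ring R]
    {X Y : ℂ → Matrix (Fin 2) (Fin 2) R} (hXY : ∀ u v i j k l, Commute (X u i j) (Y v k l))
    (u v : ℂ) (i j k l : Fin 2) :
    (X u * Y u) i j * (X v * Y v) k l =
      ∑ p, ∑ q, X u i p * X v k q * (Y u p j * Y v q l) := by
  rw [Matrix.mul_apply, Matrix.mul_apply, Finset.sum_mul_sum]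
  refine Finset.sum_congr rfl fun p _ => Finset.sum_congr rfl fun q _ => ?_
  simp only [mul_assoc]
  rw [← mul_assoc (Y u p j), ← (hXY v u k q p j).eq, mul_assoc]

lemma commute_matrix_one {R : Type*} [Ring R] (x : R) (i j : Fin 2) :
    Commute x ((1 : Matrix (Fin 2) (Fin 2) R) i j) := by
  rw [Matrix.one_apply]
  split_ifs
  exacts [Commute.one_right x, Commute.zero_right x]

variable {R : Type*} [Ring R] [Algebra ℂ R]

/-- Elements `E i j` of a ring multiplying like the matrix units of size `2`. -/
structure IsMatrixUnits (E : Matrix (Fin 2) (Fin 2) R) : Prop where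
  mul_eq : ∀ i j k l, E i j * E k l = (1 : Matrix (Fin 2) (Fin 2) ℂ) j k • E i l
  sum_eq : E 0 0 + E 1 1 = 1

/-- The Lax matrix `(u - i/2) + i P`, with operator entries, built from matrix units. -/
def laxMatrix (E : Matrix (Fin 2) (Fin 2) R) (u : ℂ) : Matrix (Fin 2) (Fin 2) R :=
  Matrix.of fun i j =>
    ((u - Complex.I / 2) * (1 : Matrix (Fin 2) (Fin 2) ℂ) i j) • (1 : R) + Complex.I • E j i

/-- The product of the Lax matrices along a list of sites. -/
def monodromy {ι : Type*} (e : ι → Matrix (Fin 2) (Fin 2) R) (s : List ι) (u : ℂ) :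
    Matrix (Fin 2) (Fin 2) R :=
  (s.map fun k => laxMatrix (e k) u).prod

@[simp]
lemma monodromy_nil {ι : Type*} (e : ι → Matrix (Fin 2) (Fin 2) R) (u : ℂ) :
    monodromy e [] u = 1 := rfl

lemma monodromy_cons {ι : Type*} (e : ι → Matrix (Fin 2) (Fin 2) R) (k : ι) (s : List ι) (u : ℂ) :
    monodromy e (k :: s) u = laxMatrix (e k) u * monodromy e s u := by
  simp [monodromy]

/-- The relation `R(u - v) T₁(u) T₂(v) = T₂(v) T₁(u) R(u - v)` for Yang's matrix
`R(u) = u + i P`, in components. -/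
def RTTRelation (T : ℂ → Matrix (Fin 2) (Fin 2) R) : Prop :=
  ∀ u v i j k l,
    (u - v) • (T u i j * T v k l) + Complex.I • (T u k j * T v i l) =
      (u - v) • (T v k l * T u i j) + Complex.I • (T v k j * T u i l)

lemma rttRelation_laxMatrix {E : Matrix (Fin 2) (Fin 2) R} (hE : IsMatrixUnits E) :
    RTTRelation (laxMatrix E) := by
  intro u v i j k l
  simp only [laxMatrix, Matrix.of_apply, add_mul, mul_add, smul_mul_assoc, mul_smul_comm, one_mul,
    mul_one, hE.mul_eq]
  module

lemma rttRelation_one : RTTRelation (fun _ => (1 : Matrix (Fin 2) (Fin 2) R)) := by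
  intro u v i j k l
  fin_cases i <;> fin_cases j <;> fin_cases k <;> fin_cases l <;> simp

/-- The usual train argument: the relation for X reorders the X-factors, entries of X and Y commute,
then the relation for Y reorders the Y-factors. -/
lemma RTTRelation.mul {X Y : ℂ → Matrix (Fin 2) (Fin 2) R} (hX : RTTRelation X)
    (hY : RTTRelation Y) (hXY : ∀ u v i j k l, Commute (X u i j) (Y v k l)) :
    RTTRelation (fun u => X u * Y u) := by
  intro u v i j k l
  simp only [mul_apply_mul_mul_apply_of_commute hXY]
  have h1 : (u - v) • ∑ p, ∑ q, X u i p * X v k q * (Y u p j * Y v q l) +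
      Complex.I • ∑ p, ∑ q, X u k p * X v i q * (Y u p j * Y v q l) =
      ∑ p, ∑ q, ((u - v) • (X v k q * X u i p) + Complex.I • (X v k p * X u i q)) *
        (Y u p j * Y v q l) := by
    simp only [Finset.smul_sum, ← Finset.sum_add_distrib]
    refine Finset.sum_congr rfl fun p _ => Finset.sum_congr rfl fun q _ => ?_
    rw [← hX u v i p k q, add_mul, smul_mul_assoc, smul_mul_assoc]
  have h2 : (u - v) • ∑ q, ∑ p, X v k q * X u i p * (Y v q l * Y u p j) +
      Complex.I • ∑ q, ∑ p, X v k q * X u i p * (Y v q j * Y u p l) =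
      ∑ q, ∑ p, X v k q * X u i p *
        ((u - v) • (Y u p j * Y v q l) + Complex.I • (Y u q j * Y v p l)) := by
    simp only [Finset.smul_sum, ← Finset.sum_add_distrib]
    refine Finset.sum_congr rfl fun q _ => Finset.sum_congr rfl fun p _ => ?_
    rw [hY u v p j q l, mul_add, mul_smul_comm, mul_smul_comm]
  rw [h1, h2]
  simp only [Fin.sum_univ_two, add_mul, mul_add, smul_mul_assoc, mul_smul_comm]
  abel

variable {ι : Type*} {e : ι → Matrix (Fin 2) (Fin 2) R}

lemma commute_laxMatrix {E : Matrix (Fin 2) (Fin 2) R} {x : R} (h : ∀ i j, Commute x (E i j))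
    (u : ℂ) (i j : Fin 2) : Commute x (laxMatrix E u i j) :=
  ((Commute.one_right x).smul_right _).add_right ((h j i).smul_right _)

lemma commute_monodromy {x : R} {s : List ι} (h : ∀ k ∈ s, ∀ i j, Commute x (e k i j))
    (u : ℂ) (i j : Fin 2) : Commute x (monodromy e s u i j) := by
  induction s generalizing i j with
  | nil => exact commute_matrix_one x i j
  | cons k s ih =>
    rw [monodromy_cons]
    exact commute_matrix_mul (commute_laxMatrix (h k (by simp)) u)
      (ih fun k' hk' => h k' (by simp [hk'])) i j

lemma commute_laxMatrix_monodromy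
    (hcomm : ∀ k k', k ≠ k' → ∀ i j p q, Commute (e k i j) (e k' p q))
    {k : ι} {s : List ι} (hk : k ∉ s) (u v : ℂ) (i j p q : Fin 2) :
    Commute (laxMatrix (e k) u i j) (monodromy e s v p q) :=
  commute_monodromy (fun k' hk' i' j' => (commute_laxMatrix (fun i'' j'' =>
    hcomm k' k (fun h => hk (h ▸ hk')) i' j' i'' j'') u i j).symm) v p q

lemma rttRelation_monodromy (he : ∀ k, IsMatrixUnits (e k))
    (hcomm : ∀ k k', k ≠ k' → ∀ i j p q, Commute (e k i j) (e k' p q))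
    {s : List ι} (hs : s.Nodup) : RTTRelation (monodromy e s) := by
  induction s with
  | nil => exact rttRelation_one
  | cons k s ih =>
    rw [List.nodup_cons] at hs
    have := (rttRelation_laxMatrix (he k)).mul (ih hs.2)
      (commute_laxMatrix_monodromy hcomm hs.1)
    simpa only [← monodromy_cons] using this

/-- The entries `B(u)` of a solution of the RTT relation commute. -/
lemma RTTRelation.commute_B {T : ℂ → Matrix (Fin 2) (Fin 2) R} (hT : RTTRelation T) (u v : ℂ) :
    Commute (T u 0 1) (T v 0 1) := by
  by_cases huv : u - v + Complex.I = 0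
  -- The scalar u - v + i in front of the commutation relation vanishes, but with u and v exchanged
  -- it is 2i.
  · have h := hT v u 0 1 0 1
    have hne : v - u + Complex.I ≠ 0 := by
      intro h'
      have : (2 : ℂ) * Complex.I = 0 := by linear_combination huv + h'
      simp at this
    rw [← add_smul, ← add_smul] at h
    exact (smul_right_injective R hne h).symm
  · have h := hT u v 0 1 0 1
    rw [← add_smul, ← add_smul] at h
    exact smul_right_injective R huv h

lemma RTTRelation.A_mul_B {T : ℂ → Matrix (Fin 2) (Fin 2) R} (hT : RTTRelation T) {u v : ℂ}
    (huv : u ≠ v) :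
    T u 0 0 * T v 0 1 = ((u - v - Complex.I) / (u - v)) • (T v 0 1 * T u 0 0) +
      (Complex.I / (u - v)) • (T u 0 1 * T v 0 0) := by
  have h := hT v u 0 1 0 0
  have hne : u - v ≠ 0 := sub_ne_zero.mpr huv
  refine smul_right_injective R hne ?_
  simp only [smul_add, smul_smul]
  rw [mul_div_cancel₀ _ hne, mul_div_cancel₀ _ hne]
  have e1 : (u - v) • (T u 0 0 * T v 0 1) = -((v - u) • (T u 0 0 * T v 0 1)) := by module
  rw [e1, eq_sub_of_add_eq h.symm]
  module

/-- Written as the relation for A with i replaced by -i, so that a single off-shell computation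
serves both entries. -/
lemma RTTRelation.D_mul_B {T : ℂ → Matrix (Fin 2) (Fin 2) R} (hT : RTTRelation T) {u v : ℂ}
    (huv : u ≠ v) :
    T u 1 1 * T v 0 1 = ((u - v - -Complex.I) / (u - v)) • (T v 0 1 * T u 1 1) +
      (-Complex.I / (u - v)) • (T u 0 1 * T v 1 1) := by
  have h := hT u v 1 1 0 1
  have hne : u - v ≠ 0 := sub_ne_zero.mpr huv
  refine smul_right_injective R hne ?_
  simp only [smul_add, smul_smul]
  rw [mul_div_cancel₀ _ hne, mul_div_cancel₀ _ hne, eq_sub_of_add_eq h]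
  module

end Yangian

/-! ### Fusion: divisibility by ε^N of the product of the two singular B's. -/

section Fusion

variable {R : Type*} [Ring R] [Algebra ℂ R] {ι : Type*} {e : ι → Matrix (Fin 2) (Fin 2) R}

/-- Twice the symmetrization, in the row indices, of the product `T(i/2 + ε) ⊗ T(-i/2 + ε)`. -/
def fusedProduct (T : ℂ → Matrix (Fin 2) (Fin 2) R) (ε : ℂ) (i k j l : Fin 2) : R :=
  T (Complex.I / 2 + ε) i j * T (-Complex.I / 2 + ε) k l +
    T (Complex.I / 2 + ε) k j * T (-Complex.I / 2 + ε) i l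

/-- At u - v = i both scalars in the RTT relation equal i, so row symmetrization equals a column
symmetrization in the opposite order, which is visibly symmetric in j and l. -/
lemma RTTRelation.fusedProduct_swap {T : ℂ → Matrix (Fin 2) (Fin 2) R} (hT : RTTRelation T)
    (ε : ℂ) (i k j l : Fin 2) : fusedProduct T ε i k j l = fusedProduct T ε i k l j := by
  have key : ∀ j l, fusedProduct T ε i k j l =
      T (-Complex.I / 2 + ε) k l * T (Complex.I / 2 + ε) i j +
        T (-Complex.I / 2 + ε) k j * T (Complex.I / 2 + ε) i l := by
    intro j l
    have h := hT (Complex.I / 2 + ε) (-Complex.I / 2 + ε) i j k l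
    have hd : Complex.I / 2 + ε - (-Complex.I / 2 + ε) = Complex.I := by ring
    rw [hd, ← smul_add, ← smul_add] at h
    exact smul_right_injective R Complex.I_ne_zero h
  rw [key, key, add_comm]

/-- Column symmetry of the X-part lets the Y-part be symmetrized as well; this counts the product
twice, whence the factor 1/2. -/
lemma RTTRelation.fusedProduct_mul {X Y : ℂ → Matrix (Fin 2) (Fin 2) R} (hX : RTTRelation X)
    (hXY : ∀ u v i j k l, Commute (X u i j) (Y v k l)) (ε : ℂ) (i k j l : Fin 2) :
    fusedProduct (fun u => X u * Y u) ε i k j l =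
      (1 / 2 : ℂ) • ∑ p, ∑ q, fusedProduct X ε i k p q * fusedProduct Y ε p q j l := by
  have h1 : fusedProduct (fun u => X u * Y u) ε i k j l =
      ∑ p, ∑ q, fusedProduct X ε i k p q *
        (Y (Complex.I / 2 + ε) p j * Y (-Complex.I / 2 + ε) q l) := by
    simp only [fusedProduct, mul_apply_mul_mul_apply_of_commute hXY,
      ← Finset.sum_add_distrib, add_mul]
  have h2 : fusedProduct (fun u => X u * Y u) ε i k j l =
      ∑ p, ∑ q, fusedProduct X ε i k p q *
        (Y (Complex.I / 2 + ε) q j * Y (-Complex.I / 2 + ε) p l) := by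
    rw [h1, Finset.sum_comm]
    refine Finset.sum_congr rfl fun p _ => Finset.sum_congr rfl fun q _ => ?_
    rw [hX.fusedProduct_swap]
  have h3 : ∑ p, ∑ q, fusedProduct X ε i k p q * fusedProduct Y ε p q j l =
      fusedProduct (fun u => X u * Y u) ε i k j l +
        fusedProduct (fun u => X u * Y u) ε i k j l := by
    nth_rewrite 1 [h1]
    rw [h2, ← Finset.sum_add_distrib]
    simp only [← Finset.sum_add_distrib, ← mul_add]
    rfl
  rw [h3, ← two_smul ℂ, smul_smul]
  norm_num

/-- The fused Lax matrix, stripped of the common factor `ε`. -/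
def fusedLax (E : Matrix (Fin 2) (Fin 2) R) (ε : ℂ) (i k j l : Fin 2) : R :=
  (ε - Complex.I) • (((1 : Matrix (Fin 2) (Fin 2) ℂ) i j * (1 : Matrix (Fin 2) (Fin 2) ℂ) k l +
      (1 : Matrix (Fin 2) (Fin 2) ℂ) k j * (1 : Matrix (Fin 2) (Fin 2) ℂ) i l) • (1 : R)) +
    Complex.I • ((1 : Matrix (Fin 2) (Fin 2) ℂ) i j • E l k +
      (1 : Matrix (Fin 2) (Fin 2) ℂ) k l • E j i + (1 : Matrix (Fin 2) (Fin 2) ℂ) k j • E l i +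
      (1 : Matrix (Fin 2) (Fin 2) ℂ) i l • E j k)

/-- The factors are ε + iP and ε - i + iP. The terms free of ε cancel under symmetrization because
of the matrix unit relations. -/
lemma fusedProduct_laxMatrix {E : Matrix (Fin 2) (Fin 2) R} (hE : IsMatrixUnits E)
    (ε : ℂ) (i k j l : Fin 2) :
    fusedProduct (laxMatrix E) ε i k j l = ε • fusedLax E ε i k j l := by
  simp only [fusedProduct, fusedLax, laxMatrix, Matrix.of_apply, add_mul, mul_add, smul_mul_assoc,
    mul_smul_comm, one_mul, mul_one, hE.mul_eq]
  module

variable [TopologicalSpace R] [IsTopologicalRing R] [ContinuousSMul ℂ R]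

lemma continuous_laxMatrix (E : Matrix (Fin 2) (Fin 2) R) : Continuous (laxMatrix E) := by
  refine continuous_pi fun i => continuous_pi fun j => ?_
  simp only [laxMatrix, Matrix.of_apply]
  fun_prop

lemma continuous_monodromy (e : ι → Matrix (Fin 2) (Fin 2) R) (s : List ι) :
    Continuous (monodromy e s) := by
  induction s with
  | nil => exact continuous_const
  | cons k s ih =>
    simp only [funext (monodromy_cons e k s)]
    exact (continuous_laxMatrix _).matrix_mul ih

/-- The fused monodromy matrix is divisible by `ε ^ N`. -/
lemma exists_fusedProduct_monodromy_eq (he : ∀ k, IsMatrixUnits (e k))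
    (hcomm : ∀ k k', k ≠ k' → ∀ i j p q, Commute (e k i j) (e k' p q))
    {s : List ι} (hs : s.Nodup) :
    ∃ G : ℂ → Fin 2 → Fin 2 → Fin 2 → Fin 2 → R,
      (∀ i k j l, Continuous fun ε => G ε i k j l) ∧
      ∀ ε i k j l, fusedProduct (monodromy e s) ε i k j l = ε ^ s.length • G ε i k j l := by
  induction s with
  | nil =>
    exact ⟨fun _ i k j l => fusedProduct (fun _ => 1) 0 i k j l, fun i k j l => continuous_const,
      fun ε i k j l => by simp [fusedProduct]⟩
  | cons a s ih =>
    rw [List.nodup_cons] at hs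
    obtain ⟨G, hG, hGe⟩ := ih hs.2
    refine ⟨fun ε i k j l => (1 / 2 : ℂ) • ∑ p, ∑ q, fusedLax (e a) ε i k p q * G ε p q j l,
      fun i k j l => ?_, fun ε i k j l => ?_⟩
    · have h1 : ∀ p q, Continuous fun ε => fusedLax (e a) ε i k p q := by
        intro p q
        unfold fusedLax
        fun_prop
      exact (continuous_finsetSum _ fun p _ => continuous_finsetSum _ fun q _ =>
        (h1 p q).mul (hG p q j l)).const_smul _
    · have h := (rttRelation_laxMatrix (he a)).fusedProduct_mul
        (commute_laxMatrix_monodromy hcomm hs.1) ε i k j l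
      simp only [← monodromy_cons] at h
      refine h.trans ?_
      rw [smul_comm (ε ^ (a :: s).length)]
      refine congrArg ((1 / 2 : ℂ) • ·) ?_
      rw [Finset.smul_sum]
      refine Finset.sum_congr rfl fun p _ => ?_
      rw [Finset.smul_sum]
      refine Finset.sum_congr rfl fun q _ => ?_
      rw [fusedProduct_laxMatrix (he a), hGe, smul_mul_assoc, mul_smul_comm, smul_smul,
        List.length_cons, pow_succ']

/-- First order expansion of the monodromy matrix, with continuous difference quotient. -/
lemma exists_monodromy_add_eq (e : ι → Matrix (Fin 2) (Fin 2) R) (s : List ι) :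
    ∃ G : ℂ → ℂ → Matrix (Fin 2) (Fin 2) R, (Continuous fun p : ℂ × ℂ => G p.1 p.2) ∧
      ∀ u h, monodromy e s (u + h) = monodromy e s u + h • G u h := by
  induction s with
  | nil => exact ⟨fun _ _ => 0, continuous_const, fun u h => by simp⟩
  | cons a s ih =>
    obtain ⟨G, hG, hGe⟩ := ih
    refine ⟨fun u h => monodromy e s (u + h) + laxMatrix (e a) u * G u h, ?_, fun u h => ?_⟩
    · exact ((continuous_monodromy e s).comp (continuous_fst.add continuous_snd)).add
        (((continuous_laxMatrix _).comp continuous_fst).matrix_mul hG)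
    · have hl : laxMatrix (e a) (u + h) = laxMatrix (e a) u + h • 1 := by
        ext i j
        simp only [laxMatrix, Matrix.of_apply, Matrix.add_apply, Matrix.smul_apply,
          Matrix.one_apply]
        split_ifs
        · module
        · simp
      rw [monodromy_cons, monodromy_cons, hl, add_mul, Matrix.smul_mul, one_mul, smul_add]
      nth_rewrite 1 [hGe]
      rw [mul_add, Matrix.mul_smul, add_assoc, add_comm (h • (_ * _))]

/-- `B(i/2 + ε + c ε^N) B(-i/2 + ε)` is divisible by `ε ^ N`. -/
lemma exists_B_mul_B_eq (he : ∀ k, IsMatrixUnits (e k))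
    (hcomm : ∀ k k', k ≠ k' → ∀ i j p q, Commute (e k i j) (e k' p q))
    {s : List ι} (hs : s.Nodup) (c : ℂ) :
    ∃ K : ℂ → R, Continuous K ∧ ∀ ε,
      monodromy e s (Complex.I / 2 + ε + c * ε ^ s.length) 0 1 *
        monodromy e s (-Complex.I / 2 + ε) 0 1 = ε ^ s.length • K ε := by
  obtain ⟨G, hG, hGe⟩ := exists_fusedProduct_monodromy_eq he hcomm hs
  obtain ⟨D, hD, hDe⟩ := exists_monodromy_add_eq e s
  refine ⟨fun ε => (1 / 2 : ℂ) • G ε 0 0 1 1 +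
    c • (D (Complex.I / 2 + ε) (c * ε ^ s.length) 0 1 * monodromy e s (-Complex.I / 2 + ε) 0 1),
    ?_, fun ε => ?_⟩
  · have h1 := hG 0 0 1 1
    have h2 : Continuous fun ε => D (Complex.I / 2 + ε) (c * ε ^ s.length) 0 1 :=
      (hD.comp (g := fun p : ℂ × ℂ => D p.1 p.2)
        (f := fun ε => (Complex.I / 2 + ε, c * ε ^ s.length)) (by fun_prop)).matrix_elem 0 1
    have h3 : Continuous fun ε => monodromy e s (-Complex.I / 2 + ε) 0 1 :=
      ((continuous_monodromy e s).comp (continuous_const.add continuous_id)).matrix_elem 0 1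
    exact (h1.const_smul _).add ((h2.mul h3).const_smul c)
  · have h := hGe ε 0 0 1 1
    -- With equal row indices the two summands of the fused product coincide, so it is 2 B(i/2 + ε)
    -- B(-i/2 + ε).
    rw [fusedProduct, ← two_smul ℂ] at h
    rw [hDe, Matrix.add_apply, Matrix.smul_apply, add_mul, smul_add, smul_comm _ (1 / 2 : ℂ), ← h,
      smul_smul, smul_mul_assoc, smul_smul, mul_comm c]
    norm_num

end Fusion

/-! ### Off-shell action of A and D on Bethe vectors. -/

section OffShell

variable {V S κ : Type*} [AddCommGroup V] [Module ℂ V] [CommRing S] [DecidableEq κ]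

/-- The off-shell action of a diagonal entry `X(u)` of the monodromy matrix on a Bethe vector. -/
lemma offShell_action (φ : S →+* Module.End ℂ V) (b : ℂ → S) (X : ℂ → Module.End ℂ V) (η : ℂ)
    (hXB : ∀ u v, u ≠ v → X u * φ (b v) = ((u - v - η) / (u - v)) • (φ (b v) * X u) +
      (η / (u - v)) • (φ (b u) * X v))
    (Ω : V) (χ : ℂ → ℂ) (hΩ : ∀ u, X u Ω = χ u • Ω) (x : κ → ℂ) (s : Finset κ)
    (hx : Set.InjOn x s) (u : ℂ) (hu : ∀ k ∈ s, u ≠ x k) :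
    X u (φ (∏ k ∈ s, b (x k)) Ω) =
      (χ u * ∏ k ∈ s, (u - x k - η) / (u - x k)) • φ (∏ k ∈ s, b (x k)) Ω +
        ∑ k ∈ s, (η / (u - x k) * (χ (x k) *
          ∏ j ∈ s.erase k, (x k - x j - η) / (x k - x j))) •
            φ (b u * ∏ j ∈ s.erase k, b (x j)) Ω := by
  induction s using Finset.induction_on generalizing u with
  | empty => simp [hΩ]
  | insert a s ha ih =>
    have hua : u ≠ x a := hu a (by simp)
    have hxs : Set.InjOn x s := hx.mono (by simp)
    have hus : ∀ k ∈ s, u ≠ x k := fun k hk => hu k (by simp [hk])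
    have has : ∀ k ∈ s, x a ≠ x k := fun k hk h => by
      have := hx (by simp) (by simp [hk]) h
      exact ha (this ▸ hk)
    have h1 : X u (φ (b (x a)) (φ (∏ k ∈ s, b (x k)) Ω)) =
        ((u - x a - η) / (u - x a)) • φ (b (x a)) (X u (φ (∏ k ∈ s, b (x k)) Ω)) +
          (η / (u - x a)) • φ (b u) (X (x a) (φ (∏ k ∈ s, b (x k)) Ω)) :=
      LinearMap.congr_fun (hXB u (x a) hua) _
    have hφ : ∀ p q : S, φ p (φ q Ω) = φ (p * q) Ω := fun p q => by
      rw [map_mul]; rfl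
    -- After passing b(x_a), the induction hypothesis is needed at u and at x_a. The diagonal term
    -- of the latter is the new unwanted term k = a; the other terms at x_a merge with those at u.
    rw [Finset.prod_insert ha, ← hφ, h1, ih hxs u hus, ih hxs (x a) has]
    simp only [map_add, map_sum, map_smul, hφ, smul_add, Finset.smul_sum, smul_smul]
    rw [Finset.sum_insert ha, Finset.erase_insert ha, Finset.prod_insert ha]
    have h2 : ∀ k ∈ s, (η / (u - x k) * (χ (x k) *
          ∏ j ∈ (insert a s).erase k, (x k - x j - η) / (x k - x j))) •
            φ (b u * ∏ j ∈ (insert a s).erase k, b (x j)) Ω =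
        ((u - x a - η) / (u - x a) * (η / (u - x k) * (χ (x k) *
          ∏ j ∈ s.erase k, (x k - x j - η) / (x k - x j)))) •
            φ (b (x a) * (b u * ∏ j ∈ s.erase k, b (x j))) Ω +
        (η / (u - x a) * (η / (x a - x k) * (χ (x k) *
          ∏ j ∈ s.erase k, (x k - x j - η) / (x k - x j)))) •
            φ (b u * (b (x a) * ∏ j ∈ s.erase k, b (x j))) Ω := by
      intro k hk
      have hak : a ≠ k := fun h => ha (h ▸ hk)
      have hae : a ∉ s.erase k := fun h => ha (Finset.mem_of_mem_erase h)
      rw [Finset.erase_insert_of_ne hak, Finset.prod_insert hae, Finset.prod_insert hae,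
        mul_left_comm (b (x a)), ← add_smul]
      congr 1
      have d1 : u - x a ≠ 0 := sub_ne_zero.mpr hua
      have d2 : u - x k ≠ 0 := sub_ne_zero.mpr (hus k hk)
      have d3 : x a - x k ≠ 0 := sub_ne_zero.mpr (has k hk)
      have d4 : x k - x a ≠ 0 := sub_ne_zero.mpr (has k hk).symm
      -- The partial fraction identity that merges the two contributions to the unwanted term k.
      have key : (u - x a - η) / (u - x a) * (η / (u - x k)) +
          η / (u - x a) * (η / (x a - x k)) =
            η / (u - x k) * ((x k - x a - η) / (x k - x a)) := by
        rw [← neg_sub (x a) (x k)]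
        field_simp
        ring
      linear_combination (-(χ (x k) * ∏ j ∈ s.erase k, (x k - x j - η) / (x k - x j))) * key
    rw [Finset.sum_congr rfl h2, Finset.sum_add_distrib]
    have h3 : χ u * ((u - x a - η) / (u - x a) * ∏ k ∈ s, (u - x k - η) / (u - x k)) =
        (u - x a - η) / (u - x a) * (χ u * ∏ k ∈ s, (u - x k - η) / (u - x k)) := by ring
    rw [h3]
    abel

end OffShell

/-! ### Expansion of the transfer matrix at u = i/2. -/

section ShiftPoint

variable {R : Type*} [Ring R] {ι : Type*} {e : ι → Matrix (Fin 2) (Fin 2) R}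

/-- The permutation operator of the sites `k` and `l`. -/
def siteSwap (e : ι → Matrix (Fin 2) (Fin 2) R) (k l : ι) : R :=
  ∑ i, ∑ j, e k i j * e l j i

/-- The product along a list of sites of the permutations of a site with the auxiliary space. -/
def permProd (e : ι → Matrix (Fin 2) (Fin 2) R) (s : List ι) : Matrix (Fin 2) (Fin 2) R :=
  (s.map fun k => (e k)ᵀ).prod

/-- The sum of the products `permProd` with one factor omitted. -/
def permProdOmit (e : ι → Matrix (Fin 2) (Fin 2) R) : List ι → Matrix (Fin 2) (Fin 2) R
  | [] => 0
  | k :: s => permProd e s + (e k)ᵀ * permProdOmit e s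

/-- The sum of the permutation operators of consecutive sites of a list. -/
def chainSwap (e : ι → Matrix (Fin 2) (Fin 2) R) : List ι → R
  | [] => 0
  | [_] => 0
  | k :: l :: s => siteSwap e k l + chainSwap e (l :: s)

lemma permProd_cons (k : ι) (s : List ι) : permProd e (k :: s) = (e k)ᵀ * permProd e s := by
  simp [permProd]

lemma permProd_append (s t : List ι) : permProd e (s ++ t) = permProd e s * permProd e t := by
  simp [permProd]

lemma permProd_singleton (k : ι) : permProd e [k] = (e k)ᵀ := by
  simp [permProd]

lemma commute_permProd {x : R} {s : List ι} (h : ∀ k ∈ s, ∀ i j, Commute x (e k i j))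
    (i j : Fin 2) : Commute x (permProd e s i j) := by
  induction s generalizing i j with
  | nil => exact commute_matrix_one x i j
  | cons k s ih =>
    rw [permProd_cons]
    exact commute_matrix_mul (fun i j => h k (by simp) j i)
      (ih fun k' hk' => h k' (by simp [hk'])) i j

lemma commute_scalar_of_forall {x : R} {M : Matrix (Fin 2) (Fin 2) R}
    (h : ∀ i j, Commute x (M i j)) : Commute (Matrix.scalar (Fin 2) x) M := by
  ext i j
  simp [(h i j).eq]

lemma trace_mul_scalar (M : Matrix (Fin 2) (Fin 2) R) (x : R) :
    (M * Matrix.scalar (Fin 2) x).trace = M.trace * x := by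
  simp [Matrix.trace, add_mul]

lemma commute_siteSwap {x : R} {k l : ι} (hk : ∀ i j, Commute x (e k i j))
    (hl : ∀ i j, Commute x (e l i j)) : Commute x (siteSwap e k l) :=
  Commute.sum_right _ _ _ fun i _ => Commute.sum_right _ _ _ fun j _ =>
    (hk i j).mul_right (hl j i)

lemma siteSwap_comm (hcomm : ∀ k k', k ≠ k' → ∀ i j p q, Commute (e k i j) (e k' p q))
    {k l : ι} (hkl : k ≠ l) : siteSwap e k l = siteSwap e l k := by
  rw [siteSwap, siteSwap, Finset.sum_comm]
  exact Finset.sum_congr rfl fun i _ => Finset.sum_congr rfl fun j _ =>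
    (hcomm k l hkl j i i j).eq

variable [Algebra ℂ R]

lemma siteSwap_mul_self (he : ∀ k, IsMatrixUnits (e k))
    (hcomm : ∀ k k', k ≠ k' → ∀ i j p q, Commute (e k i j) (e k' p q))
    {k l : ι} (hkl : k ≠ l) : siteSwap e k l * siteSwap e k l = 1 := by
  have h : ∀ i j a b, e k i j * e l j i * (e k a b * e l b a) =
      ((1 : Matrix (Fin 2) (Fin 2) ℂ) j a * (1 : Matrix (Fin 2) (Fin 2) ℂ) i b) •
        (e k i b * e l j a) := by
    intro i j a b
    rw [(hcomm l k hkl.symm j i a b).mul_mul_mul_comm, (he k).mul_eq, (he l).mul_eq,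
      smul_mul_smul_comm]
  have h1 : siteSwap e k l * siteSwap e k l =
      (e k 0 0 + e k 1 1) * (e l 0 0 + e l 1 1) := by
    simp only [siteSwap, Fin.sum_univ_two, add_mul, mul_add, h]
    simp
  rw [h1, (he k).sum_eq, (he l).sum_eq, one_mul]

/-- Exchange of an auxiliary permutation with another one. -/
lemma transpose_mul_transpose (he : ∀ k, IsMatrixUnits (e k))
    (hcomm : ∀ k k', k ≠ k' → ∀ i j p q, Commute (e k i j) (e k' p q))
    {k l : ι} (hkl : k ≠ l) :
    (e k)ᵀ * (e l)ᵀ = (e l)ᵀ * Matrix.scalar (Fin 2) (siteSwap e k l) := by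
  ext i j
  have h : ∀ a b, e l j i * (e k a b * e l b a) =
      (1 : Matrix (Fin 2) (Fin 2) ℂ) i b • (e k a b * e l j a) := by
    intro a b
    rw [← mul_assoc, (hcomm l k hkl.symm j i a b).eq, mul_assoc, (he l).mul_eq, mul_smul_comm]
  rw [Matrix.scalar_apply, Matrix.mul_diagonal, Matrix.mul_apply]
  simp only [Matrix.transpose_apply, siteSwap, Finset.mul_sum, h]
  simp [Matrix.one_apply]

lemma transpose_mul_permProd_cons (he : ∀ k, IsMatrixUnits (e k))
    (hcomm : ∀ k k', k ≠ k' → ∀ i j p q, Commute (e k i j) (e k' p q))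
    {k l : ι} {s : List ι} (hk : k ∉ l :: s) (hl : l ∉ s) :
    (e k)ᵀ * permProd e (l :: s) =
      permProd e (l :: s) * Matrix.scalar (Fin 2) (siteSwap e k l) := by
  simp only [List.mem_cons, not_or] at hk
  rw [permProd_cons, ← mul_assoc, transpose_mul_transpose he hcomm hk.1, mul_assoc, mul_assoc]
  congr 1
  refine commute_scalar_of_forall fun i j => (commute_siteSwap (e := e) ?_ ?_).symm
  · exact fun p q => (commute_permProd (fun k' hk' => hcomm k k' (by rintro rfl; exact hk.2 hk')
      p q) i j).symm
  · exact fun p q => (commute_permProd (fun k' hk' => hcomm l k' (by rintro rfl; exact hl hk')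
      p q) i j).symm

/-- Omitting a factor of the product of auxiliary permutations amounts to multiplying by the swap of
that site with the next: this is how the derivative of t produces nearest-neighbour terms. -/
lemma permProd_cons_eq_mul_swap (he : ∀ k, IsMatrixUnits (e k))
    (hcomm : ∀ k k', k ≠ k' → ∀ i j p q, Commute (e k i j) (e k' p q))
    {k l : ι} {s : List ι} (hk : k ∉ l :: s) (hl : l ∉ s) :
    permProd e (l :: s) =
      permProd e (k :: l :: s) * Matrix.scalar (Fin 2) (siteSwap e k l) := by
  have hkl : k ≠ l := fun h => hk (by simp [h])
  rw [permProd_cons k, transpose_mul_permProd_cons he hcomm hk hl, mul_assoc, ← map_mul,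
    siteSwap_mul_self he hcomm hkl, map_one, mul_one]

/-- Every omitted factor except the last has a neighbour to its right. The remaining term, which
omits z, becomes the closing link of the chain only after taking the trace. -/
lemma permProdOmit_append_singleton (he : ∀ k, IsMatrixUnits (e k))
    (hcomm : ∀ k k', k ≠ k' → ∀ i j p q, Commute (e k i j) (e k' p q))
    {s : List ι} {z : ι} (hs : (s ++ [z]).Nodup) :
    permProdOmit e (s ++ [z]) =
      permProd e (s ++ [z]) * Matrix.scalar (Fin 2) (chainSwap e (s ++ [z])) + permProd e s := by
  induction s with
  | nil => simp [permProdOmit, chainSwap, permProd]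
  | cons a s ih =>
    rw [List.cons_append, List.nodup_cons] at hs
    have ih := ih hs.2
    obtain ⟨b, r, hbr⟩ : ∃ b r, s ++ [z] = b :: r := by
      cases s with
      | nil => exact ⟨z, [], rfl⟩
      | cons b r => exact ⟨b, r ++ [z], rfl⟩
    rw [List.cons_append]
    rw [hbr] at hs ih ⊢
    rw [permProdOmit, ih, chainSwap, map_add, mul_add, mul_add,
      ← permProd_cons_eq_mul_swap he hcomm hs.1 (List.nodup_cons.mp hs.2).1,
      permProd_cons a (b :: r),
      permProd_cons a s, mul_assoc, add_assoc]

/-- Cyclicity of the trace, valid here because entries at distinct sites commute, moves site z to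
the front, where it is adjacent to a. -/
lemma trace_permProd_append_singleton (he : ∀ k, IsMatrixUnits (e k))
    (hcomm : ∀ k k', k ≠ k' → ∀ i j p q, Commute (e k i j) (e k' p q))
    {a z : ι} {s : List ι} (hs : (a :: s ++ [z]).Nodup) :
    (permProd e (a :: s)).trace =
      (permProd e (a :: s ++ [z])).trace * siteSwap e z a := by
  have hs' : (a :: s).Nodup := hs.of_append_left
  have hz : z ∉ a :: s := fun h => by
    rw [List.nodup_append] at hs
    exact hs.2.2 z h z (by simp) rfl
  have hza : z ≠ a := fun h => hz (by simp [h])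
  have h1 : (permProd e (a :: s ++ [z])).trace = ((e z)ᵀ * permProd e (a :: s)).trace := by
    rw [permProd_append, permProd_singleton]
    simp only [Matrix.trace, Matrix.diag, Matrix.mul_apply]
    rw [Finset.sum_comm]
    refine Finset.sum_congr rfl fun i _ => Finset.sum_congr rfl fun j _ => ?_
    exact (commute_permProd (fun k hk => hcomm z k (by rintro rfl; exact hz hk) _ _) _ _).eq.symm
  rw [h1, transpose_mul_permProd_cons he hcomm hz (List.nodup_cons.mp hs').1]
  rw [trace_mul_scalar, mul_assoc, siteSwap_mul_self he hcomm hza, mul_one]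

lemma permProd_mul_transpose (he : ∀ k, IsMatrixUnits (e k))
    (hcomm : ∀ k k', k ≠ k' → ∀ i j p q, Commute (e k i j) (e k' p q))
    {z : ι} {s : List ι} (hz : z ∉ s) :
    permProd e s * (e z)ᵀ =
      (e z)ᵀ * Matrix.scalar (Fin 2) (s.map fun k => siteSwap e k z).prod := by
  induction s with
  | nil => simp [permProd]
  | cons a s ih =>
    simp only [List.mem_cons, not_or] at hz
    rw [permProd_cons, mul_assoc, ih hz.2, ← mul_assoc,
      transpose_mul_transpose he hcomm (Ne.symm hz.1), mul_assoc, List.map_cons, List.prod_cons,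
      map_mul]

/-- The transfer matrix at the shift point is invertible. -/
lemma isUnit_trace_permProd (he : ∀ k, IsMatrixUnits (e k))
    (hcomm : ∀ k k', k ≠ k' → ∀ i j p q, Commute (e k i j) (e k' p q))
    {z : ι} {s : List ι} (hz : z ∉ s) : IsUnit (permProd e (s ++ [z])).trace := by
  -- Moving the last auxiliary permutation to the left leaves a product of site swaps, and its own
  -- trace is 1; each swap is an involution.
  have h1 : (permProd e (s ++ [z])).trace = (s.map fun k => siteSwap e k z).prod := by
    rw [permProd_append, permProd_singleton, permProd_mul_transpose he hcomm hz]
    simp [Matrix.trace, ← add_mul, (he z).sum_eq]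
  rw [h1]
  refine List.prod_isUnit fun x hx => ?_
  obtain ⟨k, hk, rfl⟩ := List.mem_map.mp hx
  have := siteSwap_mul_self he hcomm (k := k) (l := z) (by rintro rfl; exact hz hk)
  exact ⟨⟨_, _, this, this⟩, rfl⟩

variable [TopologicalSpace R] [IsTopologicalRing R] [ContinuousSMul ℂ R]

/-- At i/2 + ε each Lax factor is ε + i times an auxiliary permutation. Writing i^N / i avoids a
truncated exponent N - 1; for the empty list it multiplies 0. -/
lemma exists_monodromy_shiftPoint_eq (e : ι → Matrix (Fin 2) (Fin 2) R) (s : List ι) :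
    ∃ G : ℂ → Matrix (Fin 2) (Fin 2) R, Continuous G ∧
      ∀ ε, monodromy e s (Complex.I / 2 + ε) = Complex.I ^ s.length • permProd e s +
        ε • (Complex.I ^ s.length / Complex.I) • permProdOmit e s + ε ^ 2 • G ε := by
  induction s with
  | nil => exact ⟨fun _ => 0, continuous_const, fun ε => by simp [permProdOmit, permProd]⟩
  | cons a s ih =>
    obtain ⟨G, hG, hGe⟩ := ih
    refine ⟨fun ε => (Complex.I ^ s.length / Complex.I) • permProdOmit e s +
      ε • G ε + Complex.I • ((e a)ᵀ * G ε), ?_, fun ε => ?_⟩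
    · have h : Continuous fun ε => (e a)ᵀ * G ε := continuous_const.matrix_mul hG
      exact (continuous_const.add (continuous_id.smul hG)).add (h.const_smul Complex.I)
    · have hl : laxMatrix (e a) (Complex.I / 2 + ε) = ε • 1 + Complex.I • (e a)ᵀ := by
        ext i j
        simp only [laxMatrix, Matrix.of_apply, Matrix.add_apply, Matrix.smul_apply,
          Matrix.one_apply, Matrix.transpose_apply]
        split_ifs
        · module
        · simp
      rw [monodromy_cons, hGe, hl, permProdOmit, permProd_cons, List.length_cons,
        pow_succ Complex.I,
        mul_div_assoc, div_self Complex.I_ne_zero, mul_one]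
      simp only [add_mul, mul_add, Matrix.smul_mul, Matrix.mul_smul, one_mul, smul_add, smul_smul]
      have h : ε * (Complex.I ^ s.length / Complex.I) * Complex.I = ε * Complex.I ^ s.length := by
        rw [mul_assoc, div_mul_cancel₀ _ Complex.I_ne_zero]
      rw [h]
      module

lemma exists_trace_monodromy_shiftPoint_eq (he : ∀ k, IsMatrixUnits (e k))
    (hcomm : ∀ k k', k ≠ k' → ∀ i j p q, Commute (e k i j) (e k' p q))
    {a z : ι} {s : List ι} (hs : (a :: s ++ [z]).Nodup) :
    ∃ (U : R) (G : ℂ → R), IsUnit U ∧ Continuous G ∧ ∀ ε,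
      (monodromy e (a :: s ++ [z]) (Complex.I / 2 + ε)).trace =
        U + ε • (-Complex.I) • (U * (chainSwap e (a :: s ++ [z]) + siteSwap e z a)) +
          ε ^ 2 • G ε := by
  obtain ⟨G, hG, hGe⟩ := exists_monodromy_shiftPoint_eq e (a :: s ++ [z])
  have hz : z ∉ a :: s := fun h => by
    rw [List.nodup_append] at hs
    exact hs.2.2 z h z (by simp) rfl
  refine ⟨Complex.I ^ (a :: s ++ [z]).length • (permProd e (a :: s ++ [z])).trace,
    fun ε => (G ε).trace, ?_, hG.matrix_trace, fun ε => ?_⟩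
  · have hI : IsUnit (algebraMap ℂ R (Complex.I ^ (a :: s ++ [z]).length)) :=
      (IsUnit.mk0 _ (pow_ne_zero _ Complex.I_ne_zero)).map _
    rw [Algebra.smul_def]
    exact hI.mul (isUnit_trace_permProd he hcomm hz)
  · rw [hGe, permProdOmit_append_singleton he hcomm hs, Matrix.trace_add, Matrix.trace_add,
      Matrix.trace_smul, Matrix.trace_smul, Matrix.trace_smul, Matrix.trace_smul,
      Matrix.trace_add, trace_mul_scalar, trace_permProd_append_singleton he hcomm hs, ← mul_add,
      div_eq_mul_inv,
      Complex.inv_I, smul_mul_assoc, smul_smul (-Complex.I), mul_comm (-Complex.I)]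

end ShiftPoint

/-- Sites are indexed through a map from ℕ so that the induction on n does not change the type of
sites. -/
lemma chainSwap_reverse_range {R ι : Type*} [Ring R] (e : ι → Matrix (Fin 2) (Fin 2) R)
    (f : ℕ → ι) (n : ℕ) :
    chainSwap e ((List.range (n + 1)).reverse.map f) =
      ∑ j ∈ Finset.range n, siteSwap e (f (j + 1)) (f j) := by
  induction n with
  | zero => simp [chainSwap]
  | succ n ih =>
    rw [Finset.sum_range_succ, ← ih, List.range_succ, List.range_succ]
    simp only [List.reverse_append, List.reverse_singleton, List.singleton_append, List.map_cons,
      chainSwap]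
    rw [add_comm]

/-! ### The spin chain as a realization of the abstract matrix units. -/

section Sites

variable {N : ℕ}

lemma tensorOp_mul (M M' : Fin N → Matrix (Fin 2) (Fin 2) ℂ) :
    tensorOp M * tensorOp M' = tensorOp fun j => M j * M' j := by
  ext s t
  simp only [tensorOp, Matrix.mul_apply, Matrix.of_apply]
  rw [Finset.prod_univ_sum, Fintype.piFinset_univ]
  exact Finset.sum_congr rfl fun r _ => Finset.prod_mul_distrib.symm

lemma tensorOp_mulVec (M : Fin N → Matrix (Fin 2) (Fin 2) ℂ) (v : Fin N → Fin 2 → ℂ) :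
    tensorOp M *ᵥ tensorVec v = tensorVec fun j => M j *ᵥ v j := by
  ext s
  simp only [tensorOp, tensorVec, Matrix.mulVec, dotProduct, Matrix.of_apply]
  rw [Finset.prod_univ_sum, Fintype.piFinset_univ]
  exact Finset.sum_congr rfl fun r _ => Finset.prod_mul_distrib.symm

lemma siteOp_apply (k : Fin N) (A : Matrix (Fin 2) (Fin 2) ℂ) (s t : Config N) :
    siteOp k A s t = A (s k) (t k) *
      ∏ j ∈ Finset.univ.erase k, (1 : Matrix (Fin 2) (Fin 2) ℂ) (s j) (t j) := by
  rw [siteOp, tensorOp, Matrix.of_apply, ← Finset.mul_prod_erase _ _ (Finset.mem_univ k)]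
  congr 1
  · simp
  · refine Finset.prod_congr rfl fun j hj => ?_
    rw [Function.update_of_ne (Finset.ne_of_mem_erase hj)]

lemma siteOp_add (k : Fin N) (A A' : Matrix (Fin 2) (Fin 2) ℂ) :
    siteOp k (A + A') = siteOp k A + siteOp k A' := by
  ext s t
  simp [siteOp_apply, add_mul]

lemma siteOp_smul (k : Fin N) (c : ℂ) (A : Matrix (Fin 2) (Fin 2) ℂ) :
    siteOp k (c • A) = c • siteOp k A := by
  ext s t
  simp [siteOp_apply, mul_assoc]

lemma siteOp_one (k : Fin N) : siteOp k 1 = 1 := by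
  rw [siteOp, Function.update_eq_self_iff.mpr rfl]
  ext s t
  simp only [tensorOp, Matrix.of_apply, Matrix.one_apply]
  by_cases h : s = t
  · simp [h]
  · obtain ⟨j, hj⟩ := Function.ne_iff.mp h
    rw [if_neg h]
    exact Finset.prod_eq_zero (Finset.mem_univ j) (if_neg hj)

lemma siteOp_mul (k : Fin N) (A A' : Matrix (Fin 2) (Fin 2) ℂ) :
    siteOp k A * siteOp k A' = siteOp k (A * A') := by
  rw [siteOp, siteOp, tensorOp_mul, siteOp]
  congr 1
  ext j : 1
  by_cases h : j = k
  · subst h; simp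
  · simp [Function.update_of_ne h]

lemma siteOp_commute {k l : Fin N} (hkl : k ≠ l) (A A' : Matrix (Fin 2) (Fin 2) ℂ) :
    Commute (siteOp k A) (siteOp l A') := by
  rw [commute_iff_eq, siteOp, siteOp, tensorOp_mul, tensorOp_mul]
  congr 1
  ext j : 1
  by_cases h : j = k
  · subst h
    simp [Function.update_of_ne hkl]
  · simp [Function.update_of_ne h]

lemma siteOp_mulVec_vacuum (k : Fin N) (A : Matrix (Fin 2) (Fin 2) ℂ) (c : ℂ)
    (hA : A *ᵥ ![1, 0] = c • ![1, 0]) : siteOp k A *ᵥ vacuum N = c • vacuum N := by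
  rw [siteOp, vacuum, tensorOp_mulVec]
  ext s
  simp only [tensorVec, Pi.smul_apply, smul_eq_mul]
  rw [← Finset.mul_prod_erase _ _ (Finset.mem_univ k),
    ← Finset.mul_prod_erase _ _ (Finset.mem_univ k), Function.update_self, hA, ← mul_assoc]
  congr 1
  refine Finset.prod_congr rfl fun j hj => ?_
  rw [Function.update_of_ne (Finset.ne_of_mem_erase hj), Matrix.one_mulVec]

/-- The matrix units at site `k`. -/
def siteUnit (k : Fin N) : Matrix (Fin 2) (Fin 2) (Op N) :=
  Matrix.of fun i j => siteOp k (Matrix.single i j 1)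

lemma siteUnit_apply (k : Fin N) (i j : Fin 2) :
    siteUnit k i j = siteOp k (Matrix.single i j 1) := rfl

lemma siteOp_eq_sum (k : Fin N) (A : Matrix (Fin 2) (Fin 2) ℂ) :
    siteOp k A = A 0 0 • siteUnit k 0 0 + A 0 1 • siteUnit k 0 1 +
      A 1 0 • siteUnit k 1 0 + A 1 1 • siteUnit k 1 1 := by
  simp only [siteUnit_apply, ← siteOp_smul, ← siteOp_add]
  congr 1
  ext i j
  fin_cases i <;> fin_cases j <;> simp

lemma siteOp_pauli_zero (k : Fin N) :
    siteOp k (pauli 0) = siteUnit k 0 1 + siteUnit k 1 0 := by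
  rw [siteOp_eq_sum]
  simp [pauli]

lemma siteOp_pauli_one (k : Fin N) :
    siteOp k (pauli 1) = Complex.I • (siteUnit k 1 0 - siteUnit k 0 1) := by
  rw [siteOp_eq_sum]
  simp [pauli]
  module

lemma siteOp_pauli_two (k : Fin N) :
    siteOp k (pauli 2) = siteUnit k 0 0 - siteUnit k 1 1 := by
  rw [siteOp_eq_sum]
  simp [pauli, sub_eq_add_neg]

lemma isMatrixUnits_siteUnit (k : Fin N) : IsMatrixUnits (siteUnit k) where
  mul_eq i j p q := by
    rw [siteUnit_apply, siteUnit_apply, siteUnit_apply, siteOp_mul, ← siteOp_smul]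
    congr 1
    by_cases h : j = p
    · subst h; simp
    · simp [h]
  sum_eq := by
    rw [siteUnit_apply, siteUnit_apply, ← siteOp_add, ← siteOp_one k]
    congr 1
    ext i j
    fin_cases i <;> fin_cases j <;> simp

lemma commute_siteUnit (k l : Fin N) (hkl : k ≠ l) (i j p q : Fin 2) :
    Commute (siteUnit k i j) (siteUnit l p q) := siteOp_commute hkl _ _

/-- Since the sum of the σᵃ ⊗ σᵃ is 2P - 1, the operator is (u - i/2) + iP; `Matrix.comp` identifies
matrices of operators with operators on the product space. -/
lemma lOp_eq (k : Fin N) (u : ℂ) :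
    lOp k u = Matrix.comp _ _ _ _ ℂ (laxMatrix (siteUnit k) u) := by
  ext ⟨i, s⟩ ⟨j, t⟩
  rw [Matrix.comp_apply]
  have h1 : (1 : Op N) = siteUnit k 0 0 + siteUnit k 1 1 := (isMatrixUnits_siteUnit k).sum_eq.symm
  simp only [lOp, laxMatrix, Matrix.of_apply, h1, Fin.sum_univ_three, siteOp_pauli_zero,
    siteOp_pauli_one, siteOp_pauli_two, Matrix.add_apply, Matrix.sub_apply, Matrix.smul_apply,
    Matrix.kroneckerMap_apply, smul_eq_mul]
  fin_cases i <;> fin_cases j <;> simp [pauli] <;> ring_nf <;>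
    simp only [Complex.I_pow_three] <;> ring

lemma transferMatrix_eq (u : ℂ) :
    transferMatrix N u =
      Matrix.comp _ _ _ _ ℂ (monodromy siteUnit (List.finRange N).reverse u) := by
  have h : ∀ s : List (Fin N), (s.map fun k => lOp k u).prod =
      Matrix.comp _ _ _ _ ℂ (monodromy siteUnit s u) := by
    intro s
    induction s with
    | nil => exact (map_one (Matrix.compRingEquiv (Fin 2) (Config N) ℂ)).symm
    | cons k s ih =>
      rw [List.map_cons, List.prod_cons, ih, lOp_eq, monodromy_cons]
      exact (map_mul (Matrix.compRingEquiv (Fin 2) (Config N) ℂ) _ _).symm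
  exact h _

lemma bOp_eq (u : ℂ) : bOp N u = monodromy siteUnit (List.finRange N).reverse u 0 1 := by
  ext s t
  rw [bOp, Matrix.of_apply, transferMatrix_eq, Matrix.comp_apply]

lemma nodup_sites (N : ℕ) : (List.finRange N).reverse.Nodup :=
  List.nodup_reverse.mpr (List.nodup_finRange N)

lemma siteUnit_one_mulVec_vacuum (k : Fin N) (i : Fin 2) :
    siteUnit k i 1 *ᵥ vacuum N = 0 := by
  rw [siteUnit_apply, siteOp_mulVec_vacuum k _ 0, zero_smul]
  ext a
  fin_cases i <;> fin_cases a <;> simp [Matrix.mulVec, dotProduct, Matrix.single_apply]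

lemma siteUnit_zero_zero_mulVec_vacuum (k : Fin N) :
    siteUnit k 0 0 *ᵥ vacuum N = vacuum N := by
  rw [siteUnit_apply, siteOp_mulVec_vacuum k _ 1, one_smul]
  ext a
  fin_cases a <;> simp [Matrix.mulVec, dotProduct, Matrix.single_apply]

lemma monodromy_mulVec_vacuum {s : List (Fin N)} (hs : s.Nodup) (u : ℂ) :
    monodromy siteUnit s u 0 0 *ᵥ vacuum N = (u + Complex.I / 2) ^ s.length • vacuum N ∧
      monodromy siteUnit s u 1 0 *ᵥ vacuum N = 0 ∧
      monodromy siteUnit s u 1 1 *ᵥ vacuum N = (u - Complex.I / 2) ^ s.length • vacuum N := by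
  induction s with
  | nil => simp
  | cons k s ih =>
    rw [List.nodup_cons] at hs
    obtain ⟨hA, hC, hD⟩ := ih hs.2
    have lA : laxMatrix (siteUnit k) u 0 0 *ᵥ vacuum N = (u + Complex.I / 2) • vacuum N := by
      simp only [laxMatrix, Matrix.of_apply, Matrix.add_mulVec, Matrix.smul_mulVec,
        Matrix.one_mulVec, siteUnit_zero_zero_mulVec_vacuum]
      simp only [Matrix.one_apply_eq]
      module
    have lC : laxMatrix (siteUnit k) u 1 0 *ᵥ vacuum N = 0 := by
      simp [laxMatrix, Matrix.smul_mulVec, siteUnit_one_mulVec_vacuum]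
    have lD : laxMatrix (siteUnit k) u 1 1 *ᵥ vacuum N = (u - Complex.I / 2) • vacuum N := by
      simp [laxMatrix, Matrix.add_mulVec, Matrix.smul_mulVec,
        siteUnit_one_mulVec_vacuum]
    -- The lower right entry contains the Lax entry (1, 0) times the B of the remaining sites;
    -- commuting this Lax entry to the right makes it annihilate the vacuum.
    have hcomm := commute_laxMatrix_monodromy commute_siteUnit hs.1 u u 1 0 0 1
    rw [monodromy_cons]
    simp only [Matrix.mul_apply, Fin.sum_univ_two, Matrix.add_mulVec]
    rw [hcomm.eq]
    simp only [← Matrix.mulVec_mulVec, hA, hC, hD, lC, lA, lD, Matrix.mulVec_smul,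
      Matrix.mulVec_zero, smul_smul, List.length_cons, pow_succ, add_zero, zero_add, smul_zero]
    simp

/-- The scalar products of the Pauli matrices at two sites. -/
lemma sum_pauli_eq (k l : Fin N) :
    ∑ a : Fin 3, siteOp k (pauli a) * siteOp l (pauli a) = (2 : ℂ) • siteSwap siteUnit k l - 1 := by
  have h1 : (1 : Op N) = (siteUnit k 0 0 + siteUnit k 1 1) * (siteUnit l 0 0 + siteUnit l 1 1) := by
    rw [(isMatrixUnits_siteUnit k).sum_eq, (isMatrixUnits_siteUnit l).sum_eq, one_mul]
  rw [h1]
  rw [Fin.sum_univ_three, siteOp_pauli_zero, siteOp_pauli_one, siteOp_pauli_two,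
    siteOp_pauli_zero, siteOp_pauli_one, siteOp_pauli_two, smul_mul_smul_comm, Complex.I_mul_I]
  simp only [siteSwap, Fin.sum_univ_two, add_mul, mul_add, sub_mul, mul_sub]
  module

end Sites

/-! ### Bethe defects and the regularized tuple. -/

lemma prod_univ_erase_zero {M : Type*} [CommMonoid M] {n : ℕ} (f : Fin (n + 1) → M) :
    ∏ j ∈ Finset.univ.erase 0, f j = ∏ j, f (Fin.succ j) := by
  rw [Fin.univ_succ, Finset.erase_cons, Finset.prod_map]
  rfl

lemma prod_univ_erase_succ {M : Type*} [CommMonoid M] {n : ℕ} (f : Fin (n + 1) → M) (k : Fin n) :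
    ∏ j ∈ Finset.univ.erase k.succ, f j = f 0 * ∏ j ∈ Finset.univ.erase k, f (Fin.succ j) := by
  have h : (Finset.univ.erase k.succ : Finset (Fin (n + 1))) =
      Finset.cons 0 ((Finset.univ.erase k).map ⟨Fin.succ, Fin.succ_injective n⟩) (by simp) := by
    ext j
    refine Fin.cases ?_ (fun j => ?_) j
    · simp [(Fin.succ_ne_zero k).symm]
    · simp
  rw [h, Finset.prod_cons, Finset.prod_map]
  rfl

/-- The coefficient of the `k`-th unwanted term in the action of the transfer matrix. -/
def betheDefect (N : ℕ) {l : ℕ} (x : Fin l → ℂ) (k : Fin l) : ℂ :=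
  (x k + Complex.I / 2) ^ N *
      ∏ j ∈ Finset.univ.erase k, (x k - x j - Complex.I) / (x k - x j) -
    (x k - Complex.I / 2) ^ N *
      ∏ j ∈ Finset.univ.erase k, (x k - x j - -Complex.I) / (x k - x j)

/-- The regularized tuple `(i/2 + ε + c ε^N, -i/2 + ε, λ_3, …, λ_ℓ)`. -/
def regularizedTuple (N : ℕ) {m : ℕ} (μ : Fin m → ℂ) (c ε : ℂ) : Fin (m + 2) → ℂ :=
  Fin.cons (Complex.I / 2 + ε + c * ε ^ N) (Fin.cons (-Complex.I / 2 + ε) μ)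

lemma continuous_regularizedTuple (N : ℕ) {m : ℕ} (μ : Fin m → ℂ) (c : ℂ) :
    Continuous (regularizedTuple N μ c) := by
  refine continuous_pi fun j => ?_
  refine Fin.cases ?_ (fun j => Fin.cases ?_ (fun j => ?_) j) j
  · simp only [regularizedTuple, Fin.cons_zero]
    fun_prop
  · simp only [regularizedTuple, Fin.cons_zero, Fin.cons_succ]
    fun_prop
  · simp only [regularizedTuple, Fin.cons_succ]
    fun_prop

lemma regularizedTuple_zero {N : ℕ} (hN : N ≠ 0) {m : ℕ} (μ : Fin m → ℂ) (c : ℂ) :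
    regularizedTuple N μ c 0 = singularTuple μ := by
  simp [regularizedTuple, singularTuple, hN]

lemma continuousAt_betheDefect (N : ℕ) {l : ℕ} {x : Fin l → ℂ} (hx : Function.Injective x)
    (k : Fin l) : ContinuousAt (fun y : Fin l → ℂ => betheDefect N y k) x := by
  have h : ∀ c : ℂ, ContinuousAt
      (fun y : Fin l → ℂ => ∏ j ∈ Finset.univ.erase k, (y k - y j - c) / (y k - y j)) x := by
    intro c
    refine tendsto_finsetProd _ fun j hj => ?_
    refine ContinuousAt.div (by fun_prop) (by fun_prop) ?_
    exact sub_ne_zero.mpr fun h => Finset.ne_of_mem_erase hj (hx h).symm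
  have h' : ∀ c : ℂ, ContinuousAt (fun y : Fin l → ℂ => (y k + c) ^ N) x := fun c =>
    (((continuous_apply k).add continuous_const).pow N).continuousAt
  simp only [betheDefect, sub_eq_add_neg _ (Complex.I / 2)]
  exact ((h' _).mul (h _)).sub ((h' _).mul (h _))

lemma betheDefect_eq_zero {N : ℕ} {l : ℕ} {x : Fin l → ℂ} {k : Fin l}
    (h1 : x k + Complex.I / 2 ≠ 0) (h2 : x k - Complex.I / 2 ≠ 0) (h : BetheEquation N x k) :
    betheDefect N x k = 0 := by
  rw [BetheEquation, div_pow] at h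
  -- A vanishing denominator would make the right side 0 by the convention z / 0 = 0, while the left
  -- side is nonzero.
  have h3 : ∏ j ∈ Finset.univ.erase k, (x k - x j - Complex.I) ≠ 0 := by
    intro h0
    rw [Finset.prod_div_distrib, h0, div_zero, div_eq_zero_iff] at h
    rcases h with h | h
    exacts [h1 (eq_zero_of_pow_eq_zero h), h2 (eq_zero_of_pow_eq_zero h)]
  rw [Finset.prod_div_distrib, div_eq_div_iff (pow_ne_zero _ h2) h3] at h
  simp only [betheDefect, Finset.prod_div_distrib, sub_neg_eq_add]
  rw [← mul_div_assoc, ← mul_div_assoc, h, mul_comm, sub_self]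

/-! ### Vanishing of the defects, to order ε^N at the two singular entries. -/

section Singular

variable {N m : ℕ} {μ : Fin m → ℂ} {c : ℂ}

lemma singularTuple_injective_ne (hμ : Function.Injective (singularTuple μ)) (k : Fin m) :
    μ k - Complex.I / 2 ≠ 0 ∧ μ k + Complex.I / 2 ≠ 0 := by
  constructor
  · intro h
    have : singularTuple μ k.succ.succ = singularTuple μ 0 := by
      simpa [singularTuple] using sub_eq_zero.mp h
    exact Fin.succ_ne_zero _ (hμ this)
  · intro h
    have : singularTuple μ k.succ.succ = singularTuple μ (Fin.succ 0) := by
      simp only [singularTuple, Fin.cons_succ, Fin.cons_zero]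
      linear_combination h
    exact Fin.succ_ne_zero _ (Fin.succ_injective _ (hμ this))

lemma tendsto_betheDefect_succ_succ (hN : N ≠ 0) (hμ : IsSingularSolution N μ) (k : Fin m) :
    Filter.Tendsto (fun ε => betheDefect N (regularizedTuple N μ c ε) k.succ.succ) (𝓝 0)
      (𝓝 0) := by
  have h1 := (continuous_regularizedTuple N μ c).tendsto 0
  rw [regularizedTuple_zero hN] at h1
  have h2 := (continuousAt_betheDefect N hμ.1 k.succ.succ).tendsto.comp h1
  obtain ⟨h3, h4⟩ := singularTuple_injective_ne hμ.1 k
  rwa [betheDefect_eq_zero (by simpa [singularTuple] using h4)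
    (by simpa [singularTuple] using h3) (hμ.2 k)] at h2

/-- Both terms of the defect carry ε^N: one through x_1 - x_2 - i = cε^N, the other through (x_1 -
i/2)^N = ε^N (1 + cε^(N-1))^N. The first formula for c makes the quotient vanish at 0. Taking N = n
+ 2 ensures that 1 + cε^(N-1) tends to 1. -/
lemma tendsto_betheDefect_zero_div {n : ℕ} (hμ : Function.Injective (singularTuple μ))
    (hc : c = -(2 / Complex.I ^ (n + 2 + 1)) *
      ∏ j, (μ j - 3 * Complex.I / 2) / (μ j + Complex.I / 2)) :
    Filter.Tendsto (fun ε => betheDefect (n + 2) (regularizedTuple (n + 2) μ c ε) 0 / ε ^ (n + 2))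
      (𝓝[≠] 0) (𝓝 0) := by
  have hI := Complex.I_ne_zero
  have hne := singularTuple_injective_ne hμ
  let x : ℂ → ℂ := fun ε => Complex.I / 2 + ε + c * ε ^ (n + 2)
  let d : ℂ → ℂ := fun ε => Complex.I + c * ε ^ (n + 2)
  -- The defect with ε^N cancelled by hand: it agrees with the quotient for ε ≠ 0 and is continuous
  -- at 0.
  let f : ℂ → ℂ := fun ε =>
    (x ε + Complex.I / 2) ^ (n + 2) * (c / d ε * ∏ j, (x ε - μ j - Complex.I) / (x ε - μ j)) -
      (1 + c * ε ^ (n + 1)) ^ (n + 2) * ((d ε + Complex.I) / d ε *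
        ∏ j, (x ε - μ j - -Complex.I) / (x ε - μ j))
  have hx : Continuous x := by fun_prop
  have hd : Continuous d := by fun_prop
  have hx0 : x 0 = Complex.I / 2 := by simp [x]
  have hd0 : d 0 = Complex.I := by simp [d]
  have hprod : ∀ a : ℂ, ContinuousAt (fun ε => ∏ j, (x ε - μ j - a) / (x ε - μ j)) 0 := by
    intro a
    refine tendsto_finsetProd _ fun j _ => ?_
    refine ContinuousAt.div (by fun_prop) (by fun_prop) ?_
    rw [hx0, ← neg_sub]
    exact neg_ne_zero.mpr (hne j).1
  have hf : ContinuousAt f 0 := by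
    have h1 : ContinuousAt (fun ε => c / d ε) 0 :=
      ContinuousAt.div continuousAt_const hd.continuousAt (hd0 ▸ hI)
    have h2 : ContinuousAt (fun ε => (d ε + Complex.I) / d ε) 0 :=
      ContinuousAt.div (by fun_prop) hd.continuousAt (hd0 ▸ hI)
    exact ((by fun_prop : ContinuousAt (fun ε => (x ε + Complex.I / 2) ^ (n + 2)) 0).mul
      (h1.mul (hprod _))).sub
      ((by fun_prop : ContinuousAt (fun ε => (1 + c * ε ^ (n + 1)) ^ (n + 2)) 0).mul
      (h2.mul (hprod _)))
  have hf0 : f 0 = 0 := by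
    have e1 : c * ∏ j, (Complex.I / 2 - μ j - Complex.I) / (Complex.I / 2 - μ j) =
        -(2 / Complex.I ^ (n + 2 + 1)) *
          ∏ j, (Complex.I / 2 - μ j - -Complex.I) / (Complex.I / 2 - μ j) := by
      rw [hc, mul_assoc, ← Finset.prod_mul_distrib]
      congr 1
      refine Finset.prod_congr rfl fun j _ => ?_
      obtain ⟨h1, h2⟩ := hne j
      have h3 : Complex.I / 2 - μ j ≠ 0 := by rw [← neg_sub]; exact neg_ne_zero.mpr h1
      rw [div_mul_div_comm, div_eq_div_iff (mul_ne_zero h2 h3) h3]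
      ring
    have e2 : Complex.I ^ (n + 2) / Complex.I * (2 / Complex.I ^ (n + 2 + 1)) = -2 := by
      rw [div_mul_div_comm, div_eq_iff (mul_ne_zero hI (pow_ne_zero _ hI)), pow_succ _ (n + 2)]
      linear_combination (2 * Complex.I ^ (n + 2)) * Complex.I_sq
    simp only [f, hx0, hd0]
    rw [add_halves, ← two_mul, mul_div_assoc, div_self hI]
    have e3 : (1 + c * (0 : ℂ) ^ (n + 1)) ^ (n + 2) = 1 := by simp
    rw [e3]
    linear_combination (Complex.I ^ (n + 2) / Complex.I) * e1 -
      (∏ j, (Complex.I / 2 - μ j - -Complex.I) / (Complex.I / 2 - μ j)) * e2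
  have h := (hf.tendsto).mono_left (nhdsWithin_le_nhds (s := {0}ᶜ))
  rw [hf0] at h
  refine h.congr' ?_
  filter_upwards [self_mem_nhdsWithin] with ε hε
  have hε' : ε ^ (n + 2) ≠ 0 := pow_ne_zero _ hε
  rw [eq_div_iff hε', betheDefect]
  simp only [prod_univ_erase_zero, Fin.prod_univ_succ, regularizedTuple, Fin.cons_zero,
    Fin.cons_succ, f]
  have e1 : Complex.I / 2 + ε + c * ε ^ (n + 2) - (-Complex.I / 2 + ε) = d ε := by
    simp only [d]; ring
  have e2 : Complex.I / 2 + ε + c * ε ^ (n + 2) - Complex.I / 2 = ε * (1 + c * ε ^ (n + 1)) := by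
    ring
  have e3 : d ε - Complex.I = c * ε ^ (n + 2) := by simp only [d]; ring
  rw [e1, e2, e3, mul_pow, sub_neg_eq_add (d ε)]
  simp only [x]
  ring

/-- Here ε^N comes from (x_2 + i/2)^N = ε^N and from x_2 - x_1 + i = -cε^N; the second formula for c
makes the quotient vanish at 0. -/
lemma tendsto_betheDefect_one_div {n : ℕ} (hμ : Function.Injective (singularTuple μ))
    (hc : c = 2 * Complex.I ^ (n + 2 + 1) *
      ∏ j, (μ j + 3 * Complex.I / 2) / (μ j - Complex.I / 2)) :
    Filter.Tendsto
      (fun ε => betheDefect (n + 2) (regularizedTuple (n + 2) μ c ε) (Fin.succ 0) / ε ^ (n + 2))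
      (𝓝[≠] 0) (𝓝 0) := by
  have hI := Complex.I_ne_zero
  have hne := singularTuple_injective_ne hμ
  let x : ℂ → ℂ := fun ε => -Complex.I / 2 + ε
  let d : ℂ → ℂ := fun ε => -Complex.I - c * ε ^ (n + 2)
  let f : ℂ → ℂ := fun ε =>
    ((d ε - Complex.I) / d ε * ∏ j, (x ε - μ j - Complex.I) / (x ε - μ j)) -
      (x ε - Complex.I / 2) ^ (n + 2) * (-c / d ε *
        ∏ j, (x ε - μ j - -Complex.I) / (x ε - μ j))
  have hx : Continuous x := by fun_prop
  have hd : Continuous d := by fun_prop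
  have hx0 : x 0 = -Complex.I / 2 := by simp [x]
  have hd0 : d 0 = -Complex.I := by simp [d]
  have hdI : d 0 ≠ 0 := by rw [hd0]; exact neg_ne_zero.mpr hI
  have hμ' : ∀ j, -Complex.I / 2 - μ j ≠ 0 := fun j h =>
    (hne j).2 (by linear_combination -h)
  have hprod : ∀ a : ℂ, ContinuousAt (fun ε => ∏ j, (x ε - μ j - a) / (x ε - μ j)) 0 := by
    intro a
    refine tendsto_finsetProd _ fun j _ => ?_
    refine ContinuousAt.div (by fun_prop) (by fun_prop) ?_
    rw [hx0]
    exact hμ' j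
  have hf : ContinuousAt f 0 := by
    have h1 : ContinuousAt (fun ε => -c / d ε) 0 :=
      ContinuousAt.div continuousAt_const hd.continuousAt hdI
    have h2 : ContinuousAt (fun ε => (d ε - Complex.I) / d ε) 0 :=
      ContinuousAt.div (by fun_prop) hd.continuousAt hdI
    exact (h2.mul (hprod _)).sub
      ((by fun_prop : ContinuousAt (fun ε => (x ε - Complex.I / 2) ^ (n + 2)) 0).mul
      (h1.mul (hprod _)))
  have hf0 : f 0 = 0 := by
    have e1 : c * ∏ j, (-Complex.I / 2 - μ j - -Complex.I) / (-Complex.I / 2 - μ j) =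
        2 * Complex.I ^ (n + 2 + 1) *
          ∏ j, (-Complex.I / 2 - μ j - Complex.I) / (-Complex.I / 2 - μ j) := by
      rw [hc, mul_assoc, ← Finset.prod_mul_distrib]
      congr 1
      refine Finset.prod_congr rfl fun j _ => ?_
      obtain ⟨h1, h2⟩ := hne j
      have h3 := hμ' j
      rw [div_mul_div_comm, div_eq_div_iff (mul_ne_zero h1 h3) h3]
      ring
    have e2 : (-Complex.I) ^ (n + 2) * Complex.I ^ (n + 2) = 1 := by
      rw [← mul_pow]
      simp
    simp only [f, hx0, hd0]
    have e3 : -Complex.I / 2 - Complex.I / 2 = -Complex.I := by ring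
    have e4 : (-Complex.I - Complex.I) / -Complex.I = 2 := by
      rw [div_eq_iff (neg_ne_zero.mpr hI)]; ring
    have e5 : -c / -Complex.I = -c * Complex.I := by
      rw [div_eq_iff (neg_ne_zero.mpr hI)]
      linear_combination (-c) * Complex.I_sq
    rw [e3, e4, e5]
    linear_combination ((-Complex.I) ^ (n + 2) * Complex.I) * e1 +
      2 * (∏ j, (-Complex.I / 2 - μ j - Complex.I) / (-Complex.I / 2 - μ j)) *
        (Complex.I ^ 2 * e2 + Complex.I_sq)
  have h := (hf.tendsto).mono_left (nhdsWithin_le_nhds (s := {0}ᶜ))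
  rw [hf0] at h
  refine h.congr' ?_
  filter_upwards [self_mem_nhdsWithin] with ε hε
  have hε' : ε ^ (n + 2) ≠ 0 := pow_ne_zero _ hε
  rw [eq_div_iff hε', betheDefect]
  simp only [prod_univ_erase_succ, prod_univ_erase_zero, regularizedTuple, Fin.cons_zero,
    Fin.cons_succ, f]
  have e1 : -Complex.I / 2 + ε - (Complex.I / 2 + ε + c * ε ^ (n + 2)) = d ε := by
    simp only [d]; ring
  have e2 : -Complex.I / 2 + ε + Complex.I / 2 = ε := by ring
  have e3 : d ε - -Complex.I = -c * ε ^ (n + 2) := by simp only [d]; ring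
  rw [e1, e2, e3]
  simp only [x]
  ring

end Singular

/-! ### From the transfer matrix to the Hamiltonian. -/

section Eigenvector

/-- The transfer matrix, i.e. the trace over the auxiliary space of the monodromy matrix. -/
def transferTrace (N : ℕ) (u : ℂ) : Op N :=
  (monodromy siteUnit (List.finRange N).reverse u).trace

lemma reverse_finRange_eq (n : ℕ) :
    (List.finRange (n + 2)).reverse =
      (List.range (n + 2)).reverse.map (Fin.ofNat (n + 2)) := by
  rw [List.map_reverse]
  congr 1
  refine List.ext_getElem (by simp) fun i h1 h2 => ?_
  simp only [List.getElem_finRange, List.getElem_map, List.getElem_range]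
  ext
  simp at h1
  simp [Fin.ofNat, Nat.mod_eq_of_lt h1]

lemma exists_reverse_finRange_eq (n : ℕ) :
    ∃ s, (List.finRange (n + 2)).reverse = Fin.last (n + 1) :: s ++ [0] := by
  refine ⟨(List.range n).reverse.map fun j => Fin.ofNat (n + 2) (j + 1), ?_⟩
  rw [reverse_finRange_eq, List.range_succ, List.range_succ_eq_map]
  simp [Fin.ofNat, Fin.last, Function.comp_def]

/-- The open chain plus its closing link is the periodic chain; for two sites the same swap is
counted twice on both sides. -/
lemma chainSwap_add_siteSwap_eq (n : ℕ) :
    chainSwap siteUnit (List.finRange (n + 2)).reverse +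
        siteSwap siteUnit (0 : Fin (n + 2)) (Fin.last (n + 1)) =
      ∑ k : Fin (n + 2), siteSwap siteUnit k (finRotate (n + 2) k) := by
  rw [reverse_finRange_eq, chainSwap_reverse_range, Fin.sum_univ_castSucc,
    siteSwap_comm commute_siteUnit (k := 0) (by simp [Fin.ext_iff])]
  congr 1
  · rw [← Fin.sum_univ_eq_sum_range
      (fun j => siteSwap siteUnit (Fin.ofNat (n + 2) (j + 1)) (Fin.ofNat (n + 2) j))]
    refine Finset.sum_congr rfl fun j _ => ?_
    have h1 : Fin.ofNat (n + 2) (j : ℕ) = j.castSucc := by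
      ext
      simp [Fin.ofNat, Nat.mod_eq_of_lt (show (j : ℕ) < n + 2 by omega)]
    have h2 : Fin.ofNat (n + 2) ((j : ℕ) + 1) = finRotate (n + 2) j.castSucc := by
      ext
      rw [finRotate_apply]
      simp [Fin.ofNat, Nat.mod_eq_of_lt (show (j : ℕ) + 1 < n + 2 by omega)]
    rw [← h2, h1, siteSwap_comm commute_siteUnit]
    intro h
    have := congrArg Fin.val h
    simp [Fin.ofNat, Nat.mod_eq_of_lt (show (j : ℕ) + 1 < n + 2 by omega)] at this
  · rw [finRotate_last]

lemma hamiltonian_eq (n : ℕ) (J : ℂ) :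
    hamiltonian (n + 2) J = (J / 4) • ((2 : ℂ) •
      (∑ k : Fin (n + 2), siteSwap siteUnit k (finRotate (n + 2) k)) -
        (2 * ((n : ℂ) + 2)) • 1) := by
  rw [hamiltonian]
  congr 1
  simp only [sum_pauli_eq]
  rw [Finset.sum_sub_distrib, Finset.sum_sub_distrib, ← Finset.smul_sum]
  simp only [Finset.sum_const, Finset.card_univ, Fintype.card_fin]
  rw [← Nat.cast_smul_eq_nsmul ℂ]
  push_cast
  module

/-- An eigenvector of the transfer matrices near the shift point is one of the Hamiltonian. -/
lemma exists_hamiltonian_mulVec_eq {n : ℕ} (J : ℂ) {Ψ : Space (n + 2)}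
    (h : ∀ᶠ ε in 𝓝[≠] (0 : ℂ), transferTrace (n + 2) (Complex.I / 2 + ε) *ᵥ Ψ ∈
      Submodule.span ℂ {Ψ}) :
    ∃ E : ℂ, hamiltonian (n + 2) J *ᵥ Ψ = E • Ψ := by
  by_cases hΨ : Ψ = 0
  · exact ⟨0, by simp [hΨ]⟩
  obtain ⟨s, hs⟩ := exists_reverse_finRange_eq n
  have hnd := nodup_sites (n + 2)
  rw [hs] at hnd
  obtain ⟨U, G, hU, hG, hUG⟩ :=
    exists_trace_monodromy_shiftPoint_eq isMatrixUnits_siteUnit commute_siteUnit hnd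
  rw [← hs, chainSwap_add_siteSwap_eq] at hUG
  set P : Op (n + 2) := ∑ k : Fin (n + 2), siteSwap siteUnit k (finRotate (n + 2) k) with hP
  have hclosed : IsClosed (Submodule.span ℂ {Ψ} : Set (Space (n + 2))) :=
    Submodule.closed_of_finiteDimensional _
  have hGΨ : Continuous fun ε => G ε *ᵥ Ψ := hG.matrix_mulVec continuous_const
  have hform : ∀ ε, transferTrace (n + 2) (Complex.I / 2 + ε) *ᵥ Ψ =
      U *ᵥ Ψ + ε • (-Complex.I) • (U *ᵥ P *ᵥ Ψ) + ε ^ 2 • (G ε *ᵥ Ψ) := by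
    intro ε
    rw [transferTrace, hUG]
    simp only [Matrix.add_mulVec, Matrix.smul_mulVec, Matrix.mulVec_mulVec]
  -- The line spanned by Ψ is closed, so it contains the limit at ε = 0, and then the limit of the
  -- first difference quotient.
  have h1 : U *ᵥ Ψ ∈ Submodule.span ℂ {Ψ} := by
    have hc : Continuous fun ε : ℂ =>
        U *ᵥ Ψ + ε • (-Complex.I) • (U *ᵥ P *ᵥ Ψ) + ε ^ 2 • (G ε *ᵥ Ψ) := by fun_prop
    have ht := (hc.tendsto 0).mono_left (nhdsWithin_le_nhds (s := {0}ᶜ))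
    simp only [zero_smul, add_zero, ne_eq, OfNat.ofNat_ne_zero, not_false_eq_true, zero_pow] at ht
    refine hclosed.mem_of_tendsto ht (h.mono fun ε hε => ?_)
    rwa [hform] at hε
  have h2 : (-Complex.I) • (U *ᵥ P *ᵥ Ψ) ∈ Submodule.span ℂ {Ψ} := by
    have hc : Continuous fun ε : ℂ => (-Complex.I) • (U *ᵥ P *ᵥ Ψ) + ε • (G ε *ᵥ Ψ) := by
      fun_prop
    have ht := (hc.tendsto 0).mono_left (nhdsWithin_le_nhds (s := {0}ᶜ))
    simp only [zero_smul, add_zero] at ht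
    refine hclosed.mem_of_tendsto ht ?_
    filter_upwards [h, self_mem_nhdsWithin] with ε hε hε0
    rw [hform] at hε
    have h3 := Submodule.smul_mem _ ε⁻¹ (Submodule.sub_mem _ hε h1)
    have h4 : ε⁻¹ • (U *ᵥ Ψ + ε • (-Complex.I) • (U *ᵥ P *ᵥ Ψ) + ε ^ 2 • (G ε *ᵥ Ψ) - U *ᵥ Ψ) =
        (-Complex.I) • (U *ᵥ P *ᵥ Ψ) + ε • (G ε *ᵥ Ψ) := by
      have hε1 : ε⁻¹ * ε = 1 := inv_mul_cancel₀ hε0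
      have e1 : U *ᵥ Ψ + ε • (-Complex.I) • (U *ᵥ P *ᵥ Ψ) + ε ^ 2 • (G ε *ᵥ Ψ) - U *ᵥ Ψ =
        ε • ((-Complex.I) • (U *ᵥ P *ᵥ Ψ) + ε • (G ε *ᵥ Ψ)) := by module
      rw [e1, smul_smul, hε1, one_smul]
    rwa [h4] at h3
  rw [Submodule.smul_mem_iff _ (neg_ne_zero.mpr Complex.I_ne_zero)] at h2
  obtain ⟨α, hα⟩ := Submodule.mem_span_singleton.mp h1
  obtain ⟨β, hβ⟩ := Submodule.mem_span_singleton.mp h2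
  have hinj : Function.Injective (U *ᵥ ·) := Matrix.mulVec_injective_of_isUnit hU
  have hα0 : α ≠ 0 := by
    rintro rfl
    refine hΨ (hinj ?_)
    simp only [← hα, zero_smul, Matrix.mulVec_zero]
  have hPΨ : P *ᵥ Ψ = (β / α) • Ψ := by
    -- UΨ = αΨ with α ≠ 0 and UPΨ = βΨ; injectivity of U gives PΨ = (β/α)Ψ.
    refine hinj ?_
    simp only [Matrix.mulVec_smul]
    rw [← hα, ← hβ, smul_smul, div_mul_cancel₀ _ hα0]
  refine ⟨(J / 4) * (2 * (β / α) - 2 * ((n : ℂ) + 2)), ?_⟩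
  rw [hamiltonian_eq, ← hP]
  simp only [Matrix.smul_mulVec, Matrix.sub_mulVec, hPΨ, Matrix.one_mulVec]
  module

/-- For at most one site, the Hamiltonian is a scalar. -/
lemma exists_hamiltonian_eq_smul_one {N : ℕ} (hN : N < 2) (J : ℂ) :
    ∃ E : ℂ, hamiltonian N J = E • 1 := by
  interval_cases N
  · exact ⟨0, by simp [hamiltonian]⟩
  · refine ⟨J / 4 * 2, ?_⟩
    -- A single site is its own neighbour, so each σᵃσᵃ is 1 and the sum is 3 - 1 = 2.
    have h : ∀ k : Fin 1, finRotate 1 k = k := fun k => Subsingleton.elim _ _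
    have hp : ∀ a, pauli a * pauli a = 1 := by
      intro a
      ext i j
      fin_cases a <;> fin_cases i <;> fin_cases j <;> simp [pauli]
    simp only [hamiltonian, h, siteOp_mul, hp, siteOp_one]
    simp only [Finset.sum_const, Finset.card_univ, Fintype.card_fin, one_smul]
    rw [← Nat.cast_smul_eq_nsmul ℂ]
    push_cast
    module

end Eigenvector

/-! ### The limit vector as an eigenvector of the transfer matrices. -/

section BetheVectors

variable {N : ℕ}

lemma rttRelation_chain (N : ℕ) :
    RTTRelation (monodromy (siteUnit (N := N)) (List.finRange N).reverse) :=
  rttRelation_monodromy isMatrixUnits_siteUnit commute_siteUnit (nodup_sites N)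

lemma commute_bOp (u v : ℂ) : Commute (bOp N u) (bOp N v) := by
  rw [bOp_eq, bOp_eq]
  exact (rttRelation_chain N).commute_B u v

open scoped IsMulCommutative in
/-- The operators `B_N(u)` come from a commutative ring of operators. -/
lemma exists_commRing_bOp (N : ℕ) :
    ∃ (S : Type) (_ : CommRing S) (φ : S →+* Module.End ℂ (Space N)) (b : ℂ → S),
      ∀ u, φ (b u) = Matrix.toLin' (bOp N u) := by
  have hcomm : ∀ a ∈ Set.range (bOp N), ∀ b ∈ Set.range (bOp N), a * b = b * a := by
    rintro _ ⟨u, rfl⟩ _ ⟨v, rfl⟩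
    exact commute_bOp u v
  -- Commuting generators generate a commutative algebra, in which the unordered products of the
  -- off-shell formula make sense.
  have := Algebra.isMulCommutative_adjoin ℂ hcomm
  exact ⟨Algebra.adjoin ℂ (Set.range (bOp N)), inferInstance,
    ((Matrix.toLinAlgEquiv' : Op N ≃ₐ[ℂ] _).toAlgHom.comp
      (Algebra.adjoin ℂ (Set.range (bOp N))).val).toRingHom,
    fun u => ⟨bOp N u, Algebra.subset_adjoin ⟨u, rfl⟩⟩, fun u => rfl⟩

variable {S : Type} [CommRing S] {φ : S →+* Module.End ℂ (Space N)} {b : ℂ → S}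

lemma apply_prod_vacuum (hb : ∀ u, φ (b u) = Matrix.toLin' (bOp N u)) {m : ℕ} (μ : Fin m → ℂ) :
    φ (∏ j, b (μ j)) (vacuum N) = (List.ofFn fun j => bOp N (μ j)).prod *ᵥ vacuum N := by
  rw [← List.prod_ofFn, map_list_prod, List.map_ofFn]
  have h : (φ ∘ fun j => b (μ j)) = Matrix.toLinAlgEquiv' ∘ fun j => bOp N (μ j) :=
    funext fun j => hb _
  rw [h, ← List.map_ofFn, ← map_list_prod, Matrix.toLinAlgEquiv'_apply]

/-- The off-shell action of the transfer matrix on Bethe vectors. -/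
lemma transferTrace_mulVec_prod (hb : ∀ u, φ (b u) = Matrix.toLin' (bOp N u)) {l : ℕ}
    {x : Fin l → ℂ} (hx : Function.Injective x) {u : ℂ} (hu : ∀ k, u ≠ x k) :
    transferTrace N u *ᵥ φ (∏ j, b (x j)) (vacuum N) =
      ((u + Complex.I / 2) ^ N * ∏ j, (u - x j - Complex.I) / (u - x j) +
        (u - Complex.I / 2) ^ N * ∏ j, (u - x j - -Complex.I) / (u - x j)) •
          φ (∏ j, b (x j)) (vacuum N) +
        ∑ k, (Complex.I / (u - x k) * betheDefect N x k) •
          φ (b u * ∏ j ∈ Finset.univ.erase k, b (x j)) (vacuum N) := by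
  have hT := rttRelation_chain N
  have hv := fun u => monodromy_mulVec_vacuum (nodup_sites N) u
  have hlen : (List.finRange N).reverse.length = N := by simp
  rw [hlen] at hv
  have hA := offShell_action φ b
    (fun u => Matrix.toLin' (monodromy siteUnit (List.finRange N).reverse u 0 0)) Complex.I
    (fun u v huv => by
      simp only [hb, bOp_eq, Module.End.mul_eq_comp, ← Matrix.toLin'_mul]
      rw [hT.A_mul_B huv, map_add, map_smul, map_smul])
    (vacuum N) (fun u => (u + Complex.I / 2) ^ N) (fun u => (hv u).1) x Finset.univ hx.injOn u
    (fun k _ => hu k)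
  have hD := offShell_action φ b
    (fun u => Matrix.toLin' (monodromy siteUnit (List.finRange N).reverse u 1 1)) (-Complex.I)
    (fun u v huv => by
      simp only [hb, bOp_eq, Module.End.mul_eq_comp, ← Matrix.toLin'_mul]
      rw [hT.D_mul_B huv, map_add, map_smul, map_smul])
    (vacuum N) (fun u => (u - Complex.I / 2) ^ N) (fun u => (hv u).2.2) x Finset.univ hx.injOn u
    (fun k _ => hu k)
  rw [Matrix.toLin'_apply] at hA hD
  rw [transferTrace, Matrix.trace_fin_two, Matrix.add_mulVec, hA, hD, add_smul,
    add_add_add_comm, ← Finset.sum_add_distrib]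
  refine congrArg (_ + ·) (Finset.sum_congr rfl fun k _ => ?_)
  rw [← add_smul, betheDefect]
  congr 1
  ring

lemma exists_bOp_mul_bOp_eq (N : ℕ) (c : ℂ) :
    ∃ K : ℂ → Op N, Continuous K ∧ ∀ ε,
      bOp N (Complex.I / 2 + ε + c * ε ^ N) * bOp N (-Complex.I / 2 + ε) = ε ^ N • K ε := by
  obtain ⟨K, hK, h⟩ := exists_B_mul_B_eq isMatrixUnits_siteUnit commute_siteUnit (nodup_sites N) c
  have hlen : (List.finRange N).reverse.length = N := by simp
  rw [hlen] at h
  exact ⟨K, hK, fun ε => by rw [bOp_eq, bOp_eq, h]⟩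

lemma continuous_bOp (N : ℕ) : Continuous (bOp N) := by
  rw [funext (bOp_eq (N := N))]
  exact (continuous_monodromy siteUnit _).matrix_elem 0 1

lemma eventually_injective_regularizedTuple (hN : N ≠ 0) {m : ℕ} {μ : Fin m → ℂ} (c : ℂ)
    (hμ : Function.Injective (singularTuple μ)) :
    ∀ᶠ ε in 𝓝 (0 : ℂ), Function.Injective (regularizedTuple N μ c ε) := by
  have h : ∀ j k, j ≠ k → ∀ᶠ ε in 𝓝 (0 : ℂ),
      regularizedTuple N μ c ε j ≠ regularizedTuple N μ c ε k := by
    intro j k hjk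
    have hc := continuous_regularizedTuple N μ c
    have hj : Continuous fun ε => regularizedTuple N μ c ε j := (continuous_apply j).comp hc
    have hk : Continuous fun ε => regularizedTuple N μ c ε k := (continuous_apply k).comp hc
    have h0 : regularizedTuple N μ c 0 j - regularizedTuple N μ c 0 k ≠ 0 := by
      rw [regularizedTuple_zero hN]
      exact sub_ne_zero.mpr fun h => hjk (hμ h)
    exact (((hj.sub hk).tendsto 0).eventually_ne h0).mono fun ε => sub_ne_zero.mp
  have h' : ∀ᶠ ε in 𝓝 (0 : ℂ), ∀ j k, j ≠ k →
      regularizedTuple N μ c ε j ≠ regularizedTuple N μ c ε k := by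
    simp only [Filter.eventually_all]
    exact h
  filter_upwards [h'] with ε hε j k hjk
  by_contra hne
  exact hε j k hne hjk

/-- The regularized singular Bethe vector is an eigenvector of the transfer matrix. -/
lemma transferTrace_mulVec_mem_span (hN0 : N ≠ 0) {m : ℕ} {μ : Fin m → ℂ} {c : ℂ}
    (hμ : IsSingularSolution N μ)
    (h₁ : Filter.Tendsto (fun ε => betheDefect N (regularizedTuple N μ c ε) 0 / ε ^ N)
      (𝓝[≠] 0) (𝓝 0))
    (h₂ : Filter.Tendsto (fun ε => betheDefect N (regularizedTuple N μ c ε) (Fin.succ 0) / ε ^ N)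
      (𝓝[≠] 0) (𝓝 0))
    {K : ℂ → Op N} (hK : Continuous K)
    (hKe : ∀ ε, bOp N (Complex.I / 2 + ε + c * ε ^ N) * bOp N (-Complex.I / 2 + ε) = ε ^ N • K ε)
    {u : ℂ} (hu : ∀ k, u ≠ singularTuple μ k) :
    transferTrace N u *ᵥ (K 0 *ᵥ (List.ofFn fun j => bOp N (μ j)).prod *ᵥ vacuum N) ∈
      Submodule.span ℂ {K 0 *ᵥ (List.ofFn fun j => bOp N (μ j)).prod *ᵥ vacuum N} := by
  obtain ⟨S, _, φ, b, hb⟩ := exists_commRing_bOp N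
  rw [← apply_prod_vacuum hb]
  set w := φ (∏ j, b (μ j)) (vacuum N)
  let x := regularizedTuple N μ c
  have hx : Continuous x := continuous_regularizedTuple N μ c
  have hx0 : x 0 = singularTuple μ := regularizedTuple_zero hN0 μ c
  have hφ : ∀ (u : ℂ) (q : S) (v : Space N), φ (b u * q) v = bOp N u *ᵥ φ q v := fun u q v => by
    rw [map_mul, Module.End.mul_apply, hb, Matrix.toLin'_apply]
  have hBB : ∀ (ε : ℂ) (v : Space N), bOp N (regularizedTuple N μ c ε 0) *ᵥ
      bOp N (regularizedTuple N μ c ε (Fin.succ 0)) *ᵥ v = ε ^ N • (K ε *ᵥ v) := by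
    intro ε v
    rw [Matrix.mulVec_mulVec, ← Matrix.smul_mulVec, ← hKe]
    rfl
  let Λ : ℂ → ℂ := fun ε =>
    (u + Complex.I / 2) ^ N * ∏ j, (u - x ε j - Complex.I) / (u - x ε j) +
      (u - Complex.I / 2) ^ N * ∏ j, (u - x ε j - -Complex.I) / (u - x ε j)
  have hxj : ∀ j, Continuous fun ε => x ε j := fun j => (continuous_apply j).comp hx
  have hΛ : ContinuousAt Λ 0 := by
    have h : ∀ a : ℂ, ContinuousAt (fun ε => ∏ j, (u - x ε j - a) / (u - x ε j)) 0 := by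
      intro a
      refine tendsto_finsetProd _ fun j _ => ?_
      have := hxj j
      refine ContinuousAt.div (by fun_prop) (by fun_prop) ?_
      rw [hx0]
      exact sub_ne_zero.mpr (hu j)
    exact (continuousAt_const.mul (h _)).add (continuousAt_const.mul (h _))
  have hg : ∀ k, Filter.Tendsto (fun ε => Complex.I / (u - x ε k)) (𝓝[≠] 0)
      (𝓝 (Complex.I / (u - singularTuple μ k))) := by
    intro k
    have h : ContinuousAt (fun ε => Complex.I / (u - x ε k)) 0 := by
      have := hxj k
      refine ContinuousAt.div (by fun_prop) (by fun_prop) ?_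
      rw [hx0]
      exact sub_ne_zero.mpr (hu k)
    have := h.tendsto.mono_left (nhdsWithin_le_nhds (s := {0}ᶜ))
    rwa [hx0] at this
  have hB : Continuous (bOp N) := continuous_bOp N
  -- The off-shell formula divided by ε^N. Terms k ≥ 3 absorb ε^N into K; in the first two only one
  -- singular B is left, and ε^N divides the defect instead.
  have hform : ∀ᶠ ε in 𝓝[≠] (0 : ℂ), Λ ε • (K ε *ᵥ w) +
      ((Complex.I / (u - x ε 0) * (betheDefect N (x ε) 0 / ε ^ N)) •
          (bOp N u *ᵥ bOp N (x ε (Fin.succ 0)) *ᵥ w) +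
        ((Complex.I / (u - x ε (Fin.succ 0)) * (betheDefect N (x ε) (Fin.succ 0) / ε ^ N)) •
          (bOp N u *ᵥ bOp N (x ε 0) *ᵥ w) +
        ∑ k : Fin m, (Complex.I / (u - x ε k.succ.succ) * betheDefect N (x ε) k.succ.succ) •
          (bOp N u *ᵥ K ε *ᵥ φ (∏ j ∈ Finset.univ.erase k, b (μ j)) (vacuum N)))) =
      transferTrace N u *ᵥ (K ε *ᵥ w) := by
    have hne : ∀ᶠ ε in 𝓝 (0 : ℂ), ∀ k, u ≠ x ε k := by
      rw [Filter.eventually_all]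
      intro k
      refine (((hxj k).tendsto 0).eventually_ne (b₂ := u) ?_).mono fun ε => Ne.symm
      rw [hx0]
      exact (hu k).symm
    filter_upwards [nhdsWithin_le_nhds (eventually_injective_regularizedTuple hN0 c hμ.1),
      nhdsWithin_le_nhds hne, self_mem_nhdsWithin] with ε hinj hue hε
    have hεN : ε ^ N ≠ 0 := pow_ne_zero _ hε
    have h := transferTrace_mulVec_prod hb hinj hue
    have hxs : ∀ j : Fin m, regularizedTuple N μ c ε j.succ.succ = μ j := fun j => rfl
    rw [Fin.prod_univ_succ, Fin.prod_univ_succ, Fin.sum_univ_succ, Fin.sum_univ_succ] at h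
    simp only [prod_univ_erase_succ, prod_univ_erase_zero, Fin.prod_univ_succ (n := m), hxs,
      hφ, hBB, Matrix.mulVec_smul] at h
    refine smul_right_injective _ hεN ?_
    simp only [x, w, Λ, hxs]
    rw [h]
    have e1 : ∀ p q : ℂ, ε ^ N * (p * (q / ε ^ N)) = p * q := fun p q => by
      field_simp
    simp only [smul_add, Finset.smul_sum, smul_smul, e1, mul_comm (ε ^ N)]
  have hlim : Filter.Tendsto (fun ε => transferTrace N u *ᵥ (K ε *ᵥ w)) (𝓝[≠] 0)
      (𝓝 (transferTrace N u *ᵥ (K 0 *ᵥ w))) := by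
    have h : Continuous fun ε => transferTrace N u *ᵥ (K ε *ᵥ w) :=
      continuous_const.matrix_mulVec (hK.matrix_mulVec continuous_const)
    exact (h.tendsto 0).mono_left nhdsWithin_le_nhds
  have t0 : Filter.Tendsto (fun ε => Λ ε • (K ε *ᵥ w)) (𝓝[≠] 0) (𝓝 (Λ 0 • (K 0 *ᵥ w))) := by
    have h : Continuous fun ε => K ε *ᵥ w := hK.matrix_mulVec continuous_const
    exact (hΛ.tendsto.smul (h.tendsto 0)).mono_left nhdsWithin_le_nhds
  have t1 : Filter.Tendsto (fun ε => (Complex.I / (u - x ε 0) * (betheDefect N (x ε) 0 / ε ^ N)) •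
      (bOp N u *ᵥ bOp N (x ε (Fin.succ 0)) *ᵥ w)) (𝓝[≠] 0) (𝓝 0) := by
    have h : Continuous fun ε => bOp N u *ᵥ bOp N (x ε (Fin.succ 0)) *ᵥ w :=
      continuous_const.matrix_mulVec ((hB.comp (hxj _)).matrix_mulVec continuous_const)
    have := ((hg 0).mul h₁).smul
      ((h.tendsto 0).mono_left nhdsWithin_le_nhds)
    simpa only [mul_zero, zero_smul] using this
  have t2 : Filter.Tendsto (fun ε => (Complex.I / (u - x ε (Fin.succ 0)) *
      (betheDefect N (x ε) (Fin.succ 0) / ε ^ N)) •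
      (bOp N u *ᵥ bOp N (x ε 0) *ᵥ w)) (𝓝[≠] 0) (𝓝 0) := by
    have h : Continuous fun ε => bOp N u *ᵥ bOp N (x ε 0) *ᵥ w :=
      continuous_const.matrix_mulVec ((hB.comp (hxj _)).matrix_mulVec continuous_const)
    have := ((hg (Fin.succ 0)).mul h₂).smul
      ((h.tendsto 0).mono_left nhdsWithin_le_nhds)
    simpa only [mul_zero, zero_smul] using this
  have t3 : Filter.Tendsto (fun ε => ∑ k : Fin m,
      (Complex.I / (u - x ε k.succ.succ) * betheDefect N (x ε) k.succ.succ) •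
        (bOp N u *ᵥ K ε *ᵥ φ (∏ j ∈ Finset.univ.erase k, b (μ j)) (vacuum N)))
      (𝓝[≠] 0) (𝓝 0) := by
    have h0 : (0 : Space N) = ∑ _k : Fin m, 0 := Finset.sum_const_zero.symm
    rw [h0]
    refine tendsto_finsetSum _ fun k _ => ?_
    have h : Continuous fun ε =>
        bOp N u *ᵥ K ε *ᵥ φ (∏ j ∈ Finset.univ.erase k, b (μ j)) (vacuum N) :=
      continuous_const.matrix_mulVec (hK.matrix_mulVec continuous_const)
    have := ((hg k.succ.succ).mul ((tendsto_betheDefect_succ_succ (c := c) hN0 hμ k).mono_left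
      nhdsWithin_le_nhds)).smul ((h.tendsto 0).mono_left nhdsWithin_le_nhds)
    simpa only [mul_zero, zero_smul] using this
  -- All unwanted terms tend to 0, so uniqueness of limits leaves the eigenvalue equation with
  -- eigenvalue Λ(0).
  have := tendsto_nhds_unique ((t0.add (t1.add (t2.add t3))).congr' hform) hlim
  rw [← this, add_zero, add_zero, add_zero]
  exact Submodule.smul_mem _ _ (Submodule.mem_span_singleton_self _)

end BetheVectors

end HeisenbergXXX

end

/-! ### Conclusion. -/

theorem proposition2p2 (N m : ℕ) (J : ℂ) (μ : Fin m → ℂ) (c : ℂ)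
    (hμ : HeisenbergXXX.IsSingularSolution N μ)
    (hc₁ : c = -(2 / Complex.I ^ (N + 1)) *
      ∏ j, (μ j - 3 * Complex.I / 2) / (μ j + Complex.I / 2))
    (hc₂ : c = 2 * Complex.I ^ (N + 1) *
      ∏ j, (μ j + 3 * Complex.I / 2) / (μ j - Complex.I / 2)) :
    ∃ Ψ : HeisenbergXXX.Space N,
      Filter.Tendsto (fun ε : ℂ => HeisenbergXXX.regularizedBetheVector N μ c ε)
        (𝓝[≠] 0) (𝓝 Ψ) ∧
      ∃ E : ℂ, HeisenbergXXX.hamiltonian N J *ᵥ Ψ = E • Ψ ∧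
        (Ψ ≠ 0 →
          Module.End.HasEigenvector (Matrix.toLin' (HeisenbergXXX.hamiltonian N J)) E Ψ) := by
  open HeisenbergXXX in
  obtain ⟨K, hK, hKe⟩ := exists_bOp_mul_bOp_eq N c
  refine ⟨K 0 *ᵥ (List.ofFn fun j => bOp N (μ j)).prod *ᵥ vacuum N, ?_, ?_⟩
  · have h : Continuous fun ε => K ε *ᵥ (List.ofFn fun j => bOp N (μ j)).prod *ᵥ vacuum N :=
      hK.matrix_mulVec continuous_const
    refine ((h.tendsto 0).mono_left nhdsWithin_le_nhds).congr' ?_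
    filter_upwards [self_mem_nhdsWithin] with ε hε
    rw [regularizedBetheVector, hKe, ← Matrix.mulVec_mulVec, Matrix.smul_mulVec, smul_smul,
      one_div_mul_cancel (pow_ne_zero _ hε), one_smul]
  · suffices h : ∃ E : ℂ, hamiltonian N J *ᵥ
        (K 0 *ᵥ (List.ofFn fun j => bOp N (μ j)).prod *ᵥ vacuum N) =
          E • (K 0 *ᵥ (List.ofFn fun j => bOp N (μ j)).prod *ᵥ vacuum N) by
      obtain ⟨E, hE⟩ := h
      exact ⟨E, hE, fun h0 => Module.End.hasEigenvector_iff.mpr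
        ⟨Module.End.mem_eigenspace_iff.mpr hE, h0⟩⟩
    rcases lt_or_ge N 2 with hN | hN
    · obtain ⟨E, hE⟩ := exists_hamiltonian_eq_smul_one hN J
      exact ⟨E, by rw [hE, Matrix.smul_mulVec, Matrix.one_mulVec]⟩
    · obtain ⟨n, rfl⟩ := Nat.exists_eq_add_of_le' hN
      refine exists_hamiltonian_mulVec_eq J ?_
      -- The shift point i/2 is itself an entry of the tuple, so the eigenvalue relation is
      -- available only for ε ≠ 0 near 0.
      have hne : ∀ᶠ ε in 𝓝[≠] (0 : ℂ), ∀ k, Complex.I / 2 + ε ≠ singularTuple μ k := by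
        rw [Filter.eventually_all]
        intro k
        by_cases hk : singularTuple μ k = Complex.I / 2
        · filter_upwards [self_mem_nhdsWithin] with ε hε h
          rw [hk] at h
          exact hε (by simpa using h)
        · have hc : Continuous fun ε : ℂ => Complex.I / 2 + ε := by fun_prop
          refine nhdsWithin_le_nhds ((hc.tendsto 0).eventually_ne ?_)
          rw [add_zero]
          exact Ne.symm hk
      filter_upwards [hne] with ε hε
      exact transferTrace_mulVec_mem_span (by omega) hμ (tendsto_betheDefect_zero_div hμ.1 hc₁)
        (tendsto_betheDefect_one_div hμ.1 hc₂) hK hKe hε
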